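/- Let $n\in\mathbb N$ and write points of space-time $\mathbb R^{n+1}=\mathbb R\times\mathbb R^n$ as $\mathbf X=(t,x)$, with $\mathbf e_0$ the unit vector of the time axis. Let $(\Omega_{[t]})_{0\le t\le 1}$ be subsets of $\mathbb R^n$ such that $\mathbf\Omega=\{(t,x):0\le t\le1,\ x\in\Omega_{[t]}\}$ and the swept-out hypersurface $\mathbf\Gamma=\{(t,x):0\le t\le1,\ x\in\partial\Omega_{[t]}\}$ are compact, and such that near each point of $\mathbf\Gamma$ the set $\mathbf\Omega$ is given, within the slab $0\le t\le1$, by an inequality $F\le0$ with $F$ of class $C^2$, vanishing and with nonzero spatial gradient at that point. Let $\mathbf N=\nabla F/\|\nabla F\|$ be the outward unit normal along $\mathbf\Gamma$. Let $\mathbf W_\varepsilon$ be vector fields, with $\mathbf W_\varepsilon(\mathbf X)$ jointly $C^1$ in $(\varepsilon,\mathbf X)$ near $\{0\}\times\mathbf\Omega$, such that $\mathbf W=\mathbf W_0$ satisfies $\nabla\cdot\mathbf W=0$ on $\mathbf\Omega$ and $\mathbf W\cdot\mathbf N=0$ on $\mathbf\Gamma$. Let $\Phi_\varepsilon(\mathbf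 X)$ be jointly $C^2$ in $(\varepsilon,\mathbf X)$ near $\{0\}\times\mathbf\Gamma$, with $\Phi_0=\mathrm{id}$ on $\mathbf\Gamma$, let $\mathbf\Gamma_\varepsilon=\Phi_\varepsilon(\mathbf\Gamma)$ be the perturbed surface, and let $\mathbf N_\varepsilon(\mathbf X)$ be its unit normal at $\Phi_\varepsilon(\mathbf X)$ (the unit vector orthogonal to $D\Phi_\varepsilon(\mathbf X)(T_{\mathbf X}\mathbf\Gamma)$ that is continuous in $\varepsilon$ at $0$ and equals $\mathbf N(\mathbf X)$ at $\varepsilon=0$). Put $\delta\mathbf\Gamma=\frac{\partial}{\partial\varepsilon}\big|_{\varepsilon=0}\Phi_\varepsilon$ and $\delta\mathbf W=\frac{\partial}{\partial\varepsilon}\big|_{\varepsilon=0}\mathbf W_\varepsilon$. Suppose that the zero-flux condition is maintained to first order, that is, $$\frac{d}{d\varepsilon}\Big|_{\varepsilon=0}\ \mathbf W_\varepsilon(\Phi_\varepsilon(\mathbf X))\cdot\mathbf N_\varepsilon(\mathbf X)=0\qquad\text{for all }\mathbf X\in\mathbf\Gamma .$$ Call a $C^2$ parametrization $s=(s_1,\dots,s_n)\mapsto\mathbf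 X(s)\in\mathbf\Gamma$, defined near $s_0$ and with unit tangent vectors $\mathbf T_i=\frac{\partial\mathbf X}{\partial s_i}/\big\|\frac{\partial\mathbf X}{\partial s_i}\big\|$, *principal coordinates* at $\mathbf p=\mathbf X(s_0)$ if at $s_0$ the vectors $\partial\mathbf X/\partial s_i$ are orthonormal and point in principal directions ($\partial\mathbf N/\partial s_i=-\kappa_i\mathbf T_i$) and the derivatives $\partial\mathbf T_j/\partial s_i$ have no tangential component; equivalently, the $\partial\mathbf X/\partial s_i$ are orthonormal at $s_0$, and there $\partial\mathbf T_j/\partial s_i=\kappa_i\mathbf N$ if $i=j$ and $=0$ if $i\ne j$. Then: 1. At every $\mathbf p\in\mathbf\Gamma$ with $0<t<1$ principal coordinates exist, and in any principal coordinates at $\mathbf p$ the derivatives on the right-hand side below exist and $$\delta\mathbf W\cdot\mathbf N=\sum_{i=1}^n\frac{\partial}{\partial s_i}\Big((\mathbf W\cdot\mathbf T_i)(\delta\mathbf\Gamma\cdot\mathbf N)\Big)\qquad\text{at }\mathbf p .$$ 2. Suppose that the density $\rho=\mathbf W\cdot\mathbf e_0$ is positive on $\mathbf\Gamma$. If $\delta\mathbf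 W\cdot\mathbf N=0$ on $\mathbf\Gamma$ and $\delta\mathbf\Gamma\cdot\mathbf N=0$ at the points of $\mathbf\Gamma$ with $t=0$ or $t=1$, then $\delta\mathbf\Gamma\cdot\mathbf N=0$ on all of $\mathbf\Gamma$. 3. Conversely, if $\delta\mathbf\Gamma\cdot\mathbf N=0$ on $\mathbf\Gamma$, then $\delta\mathbf W\cdot\mathbf N=0$ on $\mathbf\Gamma$. -/

import Mathlib

open Filter Topology
open scoped RealInnerProductSpace

/-- Space-time `ℝ × ℝⁿ` with its Euclidean structure; coordinate `0` is time, the coordinates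
`1, …, n` are space. -/
abbrev SpaceTime (n : ℕ) : Type := EuclideanSpace ℝ (Fin (n + 1))

/-- The spatial part `x ∈ ℝⁿ` of a space-time point `X = (t, x)`. -/
noncomputable def spatialPart {n : ℕ} (X : SpaceTime n) : EuclideanSpace ℝ (Fin n) :=
  WithLp.toLp 2 (fun i : Fin n => X i.succ)

/-- The space-time set `{(t, x) : 0 ≤ t ≤ 1, x ∈ S t}` built from the spatial supports `S t`. -/
def spacetimeSupport {n : ℕ} (S : ℝ → Set (EuclideanSpace ℝ (Fin n))) : Set (SpaceTime n) :=
  {X | 0 ≤ X 0 ∧ X 0 ≤ 1 ∧ spatialPart X ∈ S (X 0)}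

/-- The swept-out hypersurface `{(t, x) : 0 ≤ t ≤ 1, x ∈ ∂(S t)}`. -/
def sweptSurface {n : ℕ} (S : ℝ → Set (EuclideanSpace ℝ (Fin n))) : Set (SpaceTime n) :=
  {X | 0 ≤ X 0 ∧ X 0 ≤ 1 ∧ spatialPart X ∈ frontier (S (X 0))}

/-- `F` is a `C²` defining function of the space-time support near `p`: inside the slab
`0 ≤ t ≤ 1` the support is `{F ≤ 0}` near `p`, and the spatial gradient of `F` at `p` is nonzero
(so that the slices `S t` have a regular boundary too, and the surface is transversal to the
hyperplanes `t = const`). -/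
structure IsDefiningFunctionAt {n : ℕ} (S : ℝ → Set (EuclideanSpace ℝ (Fin n)))
    (F : SpaceTime n → ℝ) (p : SpaceTime n) : Prop where
  contDiffAt : ContDiffAt ℝ 2 F p
  eq_zero : F p = 0
  spatial_ne_zero : ∃ i : Fin n, fderiv ℝ F p (EuclideanSpace.single i.succ 1) ≠ 0
  mem_iff : ∀ᶠ X in 𝓝 p, 0 ≤ X 0 → X 0 ≤ 1 → (X ∈ spacetimeSupport S ↔ F X ≤ 0)

/-- The supports `S t`, `0 ≤ t ≤ 1`, sweep out a compact space-time set whose swept-out boundary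
is a compact `C²` hypersurface (up to its temporal ends `t = 0` and `t = 1`). -/
structure IsRegularSweep {n : ℕ} (S : ℝ → Set (EuclideanSpace ℝ (Fin n))) : Prop where
  isCompact_support : IsCompact (spacetimeSupport S)
  isCompact_surface : IsCompact (sweptSurface S)
  exists_defining : ∀ p ∈ sweptSurface S, ∃ F : SpaceTime n → ℝ, IsDefiningFunctionAt S F p

/-- `v` is the outward unit normal, in space-time, of the swept-out hypersurface at `p`. -/
def IsOutwardUnitNormal {n : ℕ} (S : ℝ → Set (EuclideanSpace ℝ (Fin n)))
    (p v : SpaceTime n) : Prop :=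
  ∃ F : SpaceTime n → ℝ, IsDefiningFunctionAt S F p ∧ v = ‖gradient F p‖⁻¹ • gradient F p

/-- The space-time divergence `∑ₖ ∂Wₖ/∂Xₖ`. -/
noncomputable def divergence {n : ℕ} (W : SpaceTime n → SpaceTime n) (X : SpaceTime n) : ℝ :=
  ∑ k : Fin (n + 1), fderiv ℝ W X (EuclideanSpace.single k 1) k

/-- The first variation `δG (X) = ∂G_ε(X)/∂ε` at `ε = 0` of a one-parameter family `G_ε`. -/
noncomputable def firstVariation {n : ℕ} (G : ℝ → SpaceTime n → SpaceTime n) (X : SpaceTime n) :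
    SpaceTime n :=
  deriv (fun ε : ℝ => G ε X) 0

/-- A one-parameter perturbation of the swept-out hypersurface with unit normal `ν`: the point `X`
of the surface moves to `Φ ε X`, and `N ε X` is the unit normal at `Φ ε X` of the perturbed
surface, whose tangent space there is the image under the differential of `Φ ε` of the tangent
space `{v : ⟪ν X, v⟫ = 0}` of the original surface. -/
structure IsSurfacePerturbation {n : ℕ} (S : ℝ → Set (EuclideanSpace ℝ (Fin n)))
    (ν : SpaceTime n → SpaceTime n) (Φ N : ℝ → SpaceTime n → SpaceTime n) : Prop where
  contDiffAt : ∀ X ∈ sweptSurface S,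
    ContDiffAt ℝ 2 (fun q : ℝ × SpaceTime n => Φ q.1 q.2) (0, X)
  map_zero : ∀ X ∈ sweptSurface S, Φ 0 X = X
  normal_zero : ∀ X ∈ sweptSurface S, N 0 X = ν X
  normal_continuousAt : ∀ X ∈ sweptSurface S, ContinuousAt (fun ε : ℝ => N ε X) 0
  normal_unit : ∀ X ∈ sweptSurface S, ∀ᶠ ε in 𝓝 (0 : ℝ), ‖N ε X‖ = 1
  normal_orthogonal : ∀ X ∈ sweptSurface S, ∀ᶠ ε in 𝓝 (0 : ℝ),
    ∀ v : SpaceTime n, ⟪ν X, v⟫ = 0 → ⟪N ε X, fderiv ℝ (Φ ε) X v⟫ = 0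

/-- The coordinate direction `sᵢ` in the parameter domain. -/
def coordDir {n : ℕ} (i : Fin n) : Fin n → ℝ := Pi.single i 1

/-- The coordinate tangent vector `∂x/∂sᵢ` of a parametrization `x`. -/
noncomputable def coordTangent {n : ℕ} (x : (Fin n → ℝ) → SpaceTime n) (i : Fin n)
    (s : Fin n → ℝ) : SpaceTime n :=
  lineDeriv ℝ x s (coordDir i)

/-- The unit tangent vector `Tᵢ` of a parametrization `x`. -/
noncomputable def unitTangent {n : ℕ} (x : (Fin n → ℝ) → SpaceTime n) (i : Fin n)
    (s : Fin n → ℝ) : SpaceTime n :=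
  ‖coordTangent x i s‖⁻¹ • coordTangent x i s

/-- Principal coordinates at the point `p` of the swept-out hypersurface with unit normal `ν`:
a `C²` parametrization `x` of the surface near `p = x s₀`, of unit speed with orthogonal coordinate
directions at `s₀`, such that the `Tᵢ` are principal directions at `p` (eigenvectors of the shape
operator) and the derivatives `∂Tⱼ/∂sᵢ` at `s₀` have no tangential part. Together the last two
conditions say `∂Tⱼ/∂sᵢ = κᵢ ν` for `i = j` and `∂Tⱼ/∂sᵢ = 0` for `i ≠ j`, at `s₀`. -/
structure IsPrincipalCoordinates {n : ℕ} (S : ℝ → Set (EuclideanSpace ℝ (Fin n)))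
    (ν : SpaceTime n → SpaceTime n) (x : (Fin n → ℝ) → SpaceTime n) (s₀ : Fin n → ℝ)
    (p : SpaceTime n) : Prop where
  contDiffAt : ContDiffAt ℝ 2 x s₀
  base : x s₀ = p
  mem_surface : ∀ᶠ s in 𝓝 s₀, x s ∈ sweptSurface S
  orthonormal : Orthonormal ℝ (fun i : Fin n => coordTangent x i s₀)
  principal : ∃ κ : Fin n → ℝ, ∀ i : Fin n,
    HasLineDerivAt ℝ (fun s => ν (x s)) (-(κ i) • unitTangent x i s₀) s₀ (coordDir i)
  tangential_eq_zero : ∀ i j k : Fin n,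
    ⟪lineDeriv ℝ (unitTangent x j) s₀ (coordDir i), unitTangent x k s₀⟫ = 0

/-!
Near a point of the swept surface the unit normal `ν` is the restriction of the `C¹` field
`unitGradient F`, and the derivative of a function vanishing on the surface annihilates all tangent
vectors, at the temporal ends as well (`IsDefiningFunctionAt.fderiv_eq_zero_of_tangent`).

Write `W = W 0`, `Y = δΦ` and `y = ⟪Y, ν⟫`. Since `W` is tangent to the surface, the flux
`⟪W ε (Φ ε X), N ε X⟫` equals `⟪W ε (Φ ε X) - D(Φ ε) W, N ε X⟫`, whose first factor vanishes at
`ε = 0`; hence its derivative needs no derivative of `N ε`, and the linearized zero-flux condition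
reads `⟪δW, ν⟫ = ⟪D_W Y - D_Y W, ν⟫` (`IsSurfacePerturbation.inner_firstVariation`). By the symmetry
of the shape operator the tangential part of `Y` drops out, which leaves the transport equation
`⟪δW, ν⟫ = D_W y - y ⟪D_ν W, ν⟫` on the whole surface
(`IsSurfacePerturbation.inner_firstVariation_eq_transport`).

All three claims follow from it. As `W` has divergence zero, `-⟪D_ν W, ν⟫` is the trace of the
tangential derivatives of `W`, and in principal coordinates the right-hand side becomes
`∑ ∂ᵢ (⟪W, Tᵢ⟫ y)` (`IsPrincipalCoordinates.transport_eq_sum_lineDeriv`). If `⟪δW, ν⟫ = 0` and the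
density is positive, a maximum principle for `exp (-l t) y` on the compact surface gives `y = 0`
(`IsRegularSweep.eq_zero_of_transport`). If `y = 0` on the surface, its derivative along the tangent
vector `W` vanishes, and so does `⟪δW, ν⟫`.
-/

/-! ### The swept surface as a level set -/

/-- The space-time point `(t, x)`. -/
noncomputable def slicePoint {n : ℕ} (t : ℝ) (x : EuclideanSpace ℝ (Fin n)) : SpaceTime n :=
  WithLp.toLp 2 (Fin.cons t (fun i => x i) : Fin (n + 1) → ℝ)

@[simp] lemma slicePoint_zero {n : ℕ} (t : ℝ) (x : EuclideanSpace ℝ (Fin n)) :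
    slicePoint t x 0 = t := rfl

@[simp] lemma spatialPart_slicePoint {n : ℕ} (t : ℝ) (x : EuclideanSpace ℝ (Fin n)) :
    spatialPart (slicePoint t x) = x := rfl

lemma slicePoint_spatialPart {n : ℕ} (X : SpaceTime n) :
    slicePoint (X 0) (spatialPart X) = X := by
  ext i
  refine Fin.cases rfl (fun j => rfl) i

lemma continuous_slicePoint {n : ℕ} (t : ℝ) :
    Continuous (slicePoint t : EuclideanSpace ℝ (Fin n) → SpaceTime n) := by
  refine (PiLp.continuous_toLp 2 _).comp (continuous_pi fun i => ?_)
  refine Fin.cases ?_ (fun j => ?_) i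
  · simpa using continuous_const
  · simpa using PiLp.continuous_apply 2 _ j

lemma continuous_spatialPart {n : ℕ} :
    Continuous (spatialPart : SpaceTime n → EuclideanSpace ℝ (Fin n)) :=
  (PiLp.continuous_toLp 2 _).comp (continuous_pi fun j => PiLp.continuous_apply 2 _ j.succ)

lemma continuous_time {n : ℕ} : Continuous (fun X : SpaceTime n => X 0) :=
  PiLp.continuous_apply 2 _ 0

/-- A line in a spatial direction stays in its time slice. -/
lemma add_smul_spatial_time {n : ℕ} (X : SpaceTime n) (i : Fin n) (τ c : ℝ) :
    (X + τ • (c • EuclideanSpace.single i.succ (1 : ℝ) : SpaceTime n)) 0 = X 0 := by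
  simp

lemma IsRegularSweep.isClosed_slice {n : ℕ} {S : ℝ → Set (EuclideanSpace ℝ (Fin n))}
    (hS : IsRegularSweep S) {t : ℝ} (h0 : 0 ≤ t) (h1 : t ≤ 1) : IsClosed (S t) := by
  have h := hS.isCompact_support.isClosed.preimage (continuous_slicePoint t)
  convert h using 1
  ext x
  simp [spacetimeSupport, h0, h1]

lemma IsRegularSweep.surface_subset_support {n : ℕ} {S : ℝ → Set (EuclideanSpace ℝ (Fin n))}
    (hS : IsRegularSweep S) : sweptSurface S ⊆ spacetimeSupport S := fun _ hX =>
  ⟨hX.1, hX.2.1, (hS.isClosed_slice hX.1 hX.2.1).frontier_subset hX.2.2⟩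

lemma hasDerivAt_add_smul {E : Type*} [NormedAddCommGroup E] [NormedSpace ℝ E] (X v : E) (τ : ℝ) :
    HasDerivAt (fun τ : ℝ => X + τ • v) v τ := by
  simpa using ((hasDerivAt_id τ).smul_const v).const_add X

/-- The derivative of a function along a straight line. -/
lemma DifferentiableAt.hasDerivAt_line {E G : Type*} [NormedAddCommGroup E] [NormedSpace ℝ E]
    [NormedAddCommGroup G] [NormedSpace ℝ G] {f : E → G} {X : E} (hf : DifferentiableAt ℝ f X)
    (v : E) : HasDerivAt (fun τ : ℝ => f (X + τ • v)) (fderiv ℝ f X v) 0 :=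
  hf.hasFDerivAt.hasLineDerivAt v

/-- Near a point with a `C²` defining function `F`, the other points of the slab at which `F`
vanishes have `F` as a defining function, too. -/
lemma IsDefiningFunctionAt.eventually_isDefiningFunctionAt {n : ℕ}
    {S : ℝ → Set (EuclideanSpace ℝ (Fin n))} {F : SpaceTime n → ℝ} {p : SpaceTime n}
    (hF : IsDefiningFunctionAt S F p) :
    ∀ᶠ X in 𝓝 p, F X = 0 → IsDefiningFunctionAt S F X := by
  obtain ⟨i, hi⟩ := hF.spatial_ne_zero
  have hd : ContinuousAt (fun X => fderiv ℝ F X (EuclideanSpace.single i.succ 1)) p :=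
    (hF.contDiffAt.continuousAt_fderiv (by norm_num)).clm_apply continuousAt_const
  filter_upwards [hF.contDiffAt.eventually (by simp), hd.eventually_ne hi,
    hF.mem_iff.eventually_nhds] with X h1 h2 h3 h0
  exact ⟨h1, h0, ⟨i, h2⟩, h3⟩

/-- Inside the slab, a zero of a defining function is a point of the surface. -/
lemma IsDefiningFunctionAt.mem_surface {n : ℕ}
    {S : ℝ → Set (EuclideanSpace ℝ (Fin n))} {F : SpaceTime n → ℝ} {X : SpaceTime n}
    (hF : IsDefiningFunctionAt S F X) (h0 : 0 ≤ X 0) (h1 : X 0 ≤ 1) : X ∈ sweptSurface S := by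
  refine ⟨h0, h1, ?_⟩
  have hX : X ∈ spacetimeSupport S := (hF.mem_iff.self_of_nhds h0 h1).2 hF.eq_zero.le
  refine ⟨subset_closure hX.2.2, fun hint => ?_⟩
  obtain ⟨i, hi⟩ := hF.spatial_ne_zero
  apply hi
  -- If the slice contained a neighbourhood of the point, `F` would have a local maximum there
  -- along every spatial line.
  have hd := (hF.contDiffAt.differentiableAt (by norm_num)).hasDerivAt_line
    (EuclideanSpace.single i.succ (1 : ℝ))
  refine IsLocalMax.hasDerivAt_eq_zero (a := 0) ?_ hd
  have hc : Tendsto (fun τ : ℝ => X + τ • (EuclideanSpace.single i.succ (1 : ℝ) : SpaceTime n))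
      (𝓝 0) (𝓝 X) := by
    simpa using (hasDerivAt_add_smul X (EuclideanSpace.single i.succ (1 : ℝ)) 0).continuousAt.tendsto
  have hsp := (continuous_spatialPart.tendsto X).comp hc
  filter_upwards [hc.eventually hF.mem_iff, hsp.eventually (mem_interior_iff_mem_nhds.1 hint)]
    with τ h2 h3
  have ht : (X + τ • (EuclideanSpace.single i.succ (1 : ℝ) : SpaceTime n)) 0 = X 0 := by simp
  have : F (X + τ • EuclideanSpace.single i.succ (1 : ℝ)) ≤ 0 :=
    (h2 (ht ▸ h0) (ht ▸ h1)).1 ⟨ht ▸ h0, ht ▸ h1, by rw [ht]; exact h3⟩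
  simpa [hF.eq_zero] using this

lemma IsDefiningFunctionAt.eventually_eq_zero {n : ℕ}
    {S : ℝ → Set (EuclideanSpace ℝ (Fin n))} (hS : IsRegularSweep S) {F : SpaceTime n → ℝ}
    {p : SpaceTime n} (hF : IsDefiningFunctionAt S F p) :
    ∀ᶠ X in 𝓝 p, X ∈ sweptSurface S → F X = 0 := by
  filter_upwards [hF.contDiffAt.eventually (by simp), hF.mem_iff.eventually_nhds] with X h1 h3 hX
  have hle : F X ≤ 0 := (h3.self_of_nhds hX.1 hX.2.1).1 (hS.surface_subset_support hX)
  by_contra hne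
  have hlt : F X < 0 := lt_of_le_of_ne hle hne
  apply hX.2.2.2
  rw [mem_interior_iff_mem_nhds]
  have hc : Tendsto (slicePoint (X 0)) (𝓝 (spatialPart X)) (𝓝 X) := by
    simpa [slicePoint_spatialPart] using (continuous_slicePoint (X 0)).tendsto (spatialPart X)
  filter_upwards [hc.eventually h3, hc.eventually (h1.continuousAt.eventually_lt_const hlt)]
    with x h4 h5
  exact ((h4 hX.1 hX.2.1).2 h5.le).2.2

lemma IsDefiningFunctionAt.eventually_surface {n : ℕ}
    {S : ℝ → Set (EuclideanSpace ℝ (Fin n))} (hS : IsRegularSweep S) {F : SpaceTime n → ℝ}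
    {p : SpaceTime n} (hF : IsDefiningFunctionAt S F p) :
    ∀ᶠ X in 𝓝 p, X ∈ sweptSurface S → IsDefiningFunctionAt S F X := by
  filter_upwards [hF.eventually_isDefiningFunctionAt, hF.eventually_eq_zero hS] with X h1 h2 hX
  exact h1 (h2 hX)

/-! ### A chart straightening the surface -/

/-- The unit vector field in the direction of the gradient of `F`. -/
noncomputable def unitGradient {n : ℕ} (F : SpaceTime n → ℝ) (X : SpaceTime n) : SpaceTime n :=
  ‖gradient F X‖⁻¹ • gradient F X

lemma IsDefiningFunctionAt.gradient_ne_zero {n : ℕ}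
    {S : ℝ → Set (EuclideanSpace ℝ (Fin n))} {F : SpaceTime n → ℝ} {p : SpaceTime n}
    (hF : IsDefiningFunctionAt S F p) : gradient F p ≠ 0 := by
  intro h
  obtain ⟨i, hi⟩ := hF.spatial_ne_zero
  rw [← inner_gradient_left, h, inner_zero_left] at hi
  exact hi rfl

lemma IsDefiningFunctionAt.norm_unitGradient {n : ℕ}
    {S : ℝ → Set (EuclideanSpace ℝ (Fin n))} {F : SpaceTime n → ℝ} {p : SpaceTime n}
    (hF : IsDefiningFunctionAt S F p) : ‖unitGradient F p‖ = 1 := by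
  have := norm_ne_zero_iff.2 hF.gradient_ne_zero
  simp [unitGradient, norm_smul, this]

lemma inner_unitGradient {n : ℕ} (F : SpaceTime n → ℝ) (p v : SpaceTime n) :
    ⟪unitGradient F p, v⟫ = ‖gradient F p‖⁻¹ * fderiv ℝ F p v := by
  rw [unitGradient, real_inner_smul_left, inner_gradient_left]

lemma IsDefiningFunctionAt.inner_unitGradient_eq_zero_iff {n : ℕ}
    {S : ℝ → Set (EuclideanSpace ℝ (Fin n))} {F : SpaceTime n → ℝ} {p : SpaceTime n}
    (hF : IsDefiningFunctionAt S F p) (v : SpaceTime n) :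
    ⟪unitGradient F p, v⟫ = 0 ↔ fderiv ℝ F p v = 0 := by
  simp [inner_unitGradient, hF.gradient_ne_zero]

/-- A local diffeomorphism `χ`, tangent to a translation at the origin, that carries the tangent
space of the surface into the zero set of the defining function, moving points in the normal
direction only. It is the inverse of `X ↦ (X - p) + (F X / ‖∇F p‖ - ⟪ν, X - p⟫) ν`. -/
lemma IsDefiningFunctionAt.exists_chart {n : ℕ}
    {S : ℝ → Set (EuclideanSpace ℝ (Fin n))} {F : SpaceTime n → ℝ} {p : SpaceTime n}
    (hF : IsDefiningFunctionAt S F p) :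
    ∃ χ : SpaceTime n → SpaceTime n, ContDiffAt ℝ 2 χ 0 ∧ χ 0 = p ∧
      HasFDerivAt χ (ContinuousLinearMap.id ℝ (SpaceTime n)) 0 ∧
      (∀ᶠ v in 𝓝 0, ⟪unitGradient F p, v⟫ = 0 → F (χ v) = 0) ∧
      ∀ᶠ v in 𝓝 0, ∀ a, ⟪unitGradient F p, a⟫ = 0 → ⟪χ v, a⟫ = ⟪p, a⟫ + ⟪v, a⟫ := by
  set u := unitGradient F p with hu
  set c := ‖gradient F p‖⁻¹ with hc
  have hc0 : c ≠ 0 := inv_ne_zero (norm_ne_zero_iff.2 hF.gradient_ne_zero)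
  have hu1 : ⟪u, u⟫ = 1 := by rw [real_inner_self_eq_norm_sq, hF.norm_unitGradient]; norm_num
  let Ψ : SpaceTime n → SpaceTime n := fun X => (X - p) + (c * F X - ⟪u, X - p⟫) • u
  have hΨ2 : ContDiffAt ℝ 2 Ψ p := by
    have := hF.contDiffAt
    have hc : ContDiffAt ℝ 2 (fun X => c * F X - ⟪u, X - p⟫) p :=
      (contDiffAt_const.mul this).sub
        (contDiffAt_const.inner ℝ (contDiffAt_id.sub contDiffAt_const))
    exact (contDiffAt_id.sub contDiffAt_const).add (hc.smul (contDiffAt_const (c := u)))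
  have hΨp : Ψ p = 0 := by simp [Ψ, hF.eq_zero]
  have hΨ' : HasFDerivAt Ψ ((ContinuousLinearEquiv.refl ℝ (SpaceTime n) :
      SpaceTime n ≃L[ℝ] SpaceTime n) : SpaceTime n →L[ℝ] SpaceTime n) p := by
    have hFd := (hF.contDiffAt.differentiableAt (by norm_num)).hasFDerivAt
    have h1 : HasFDerivAt (fun X : SpaceTime n => X - p) (ContinuousLinearMap.id ℝ _) p :=
      (hasFDerivAt_id p).sub_const p
    have h2 : HasFDerivAt (fun X : SpaceTime n => ⟪u, X - p⟫)
        ((innerSL ℝ u).comp (ContinuousLinearMap.id ℝ _)) p :=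
      (innerSL ℝ u).hasFDerivAt.comp p h1
    have h3 := h1.add (((hFd.const_mul c).sub h2).smul_const u)
    refine h3.congr_fderiv ?_
    ext1 v
    have : c * fderiv ℝ F p v = ⟪u, v⟫ := (inner_unitGradient F p v).symm
    simp [this]
  have hst := hΨ2.hasStrictFDerivAt' hΨ' (by norm_num)
  have hχ2 := hΨ2.to_localInverse hΨ' (by norm_num)
  have hχ0 : hst.localInverse Ψ _ p (Ψ p) = p := hst.localInverse_apply_image
  have hχ' := hst.to_localInverse.hasFDerivAt
  have hinv := hst.eventually_right_inverse
  rw [hΨp] at hχ2 hχ0 hχ' hinv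
  refine ⟨hst.localInverse Ψ _ p, hχ2, hχ0, hχ', ?_, ?_⟩
  · filter_upwards [hinv] with v hv h0
    set X := hst.localInverse Ψ _ p v
    rw [← hv] at h0
    have : ⟪u, Ψ X⟫ = c * F X := by
      simp only [Ψ, inner_add_right, real_inner_smul_right, hu1]; ring
    rw [this] at h0
    exact (mul_eq_zero.1 h0).resolve_left hc0
  · filter_upwards [hinv] with v hv a ha
    set X := hst.localInverse Ψ _ p v
    rw [← hv]
    simp only [Ψ, inner_add_left, real_inner_smul_left, inner_sub_left, ha]; ring

/-! ### Tangential derivatives -/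

/-- A function that vanishes to the right of a point has vanishing derivative there. -/
lemma HasDerivAt.eq_zero_of_eventually_right {G : Type*} [NormedAddCommGroup G] [NormedSpace ℝ G]
    {f : ℝ → G} {f' : G} {x : ℝ} (hf : HasDerivAt f f' x) (hx : f x = 0)
    (h : ∀ᶠ τ in 𝓝[>] x, f τ = 0) : f' = 0 := by
  have h1 : HasDerivWithinAt f 0 (Set.Ioi x) x :=
    (hasDerivWithinAt_const x (Set.Ioi x) (0 : G)).congr_of_eventuallyEq h hx
  exact (uniqueDiffWithinAt_Ioi x).eq_deriv _ hf.hasDerivWithinAt h1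

lemma HasDerivAt.eventually_gt_right {f : ℝ → ℝ} {f' x : ℝ} (hf : HasDerivAt f f' x)
    (h : 0 < f') : ∀ᶠ τ in 𝓝[>] x, f x < f τ := by
  have h1 := (hasDerivWithinAt_iff_tendsto_slope' (s := Set.Ioi x) (by simp)).1
    hf.hasDerivWithinAt
  filter_upwards [h1.eventually_const_lt h, self_mem_nhdsWithin] with τ h2 h3
  rw [slope_def_field] at h2
  have := (div_pos_iff_of_pos_right (sub_pos.2 h3)).1 h2
  linarith

/-- The derivative of a function that vanishes on the surface annihilates the tangent space, at
the temporal ends of the surface too: the tangent vectors that point into the slab are velocities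
of curves in the surface, and they span the tangent space because it contains vectors with a
nonzero time component. -/
lemma IsDefiningFunctionAt.fderiv_eq_zero_of_tangent {n : ℕ}
    {S : ℝ → Set (EuclideanSpace ℝ (Fin n))} {F : SpaceTime n → ℝ}
    {p : SpaceTime n} (hF : IsDefiningFunctionAt S F p) (hp : p ∈ sweptSurface S)
    {G : Type*} [NormedAddCommGroup G] [NormedSpace ℝ G] {g : SpaceTime n → G}
    (hg : DifferentiableAt ℝ g p) (h0 : ∀ᶠ X in 𝓝 p, X ∈ sweptSurface S → g X = 0)
    {a : SpaceTime n} (ha : ⟪unitGradient F p, a⟫ = 0) : fderiv ℝ g p a = 0 := by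
  obtain ⟨χ, -, hχ0, hχ', hχF, -⟩ := hF.exists_chart
  have hcurve : ∀ a : SpaceTime n, HasDerivAt (fun τ : ℝ => χ (τ • a)) a 0 := fun a => by
    simpa [HasLineDerivAt] using hχ'.hasLineDerivAt a
  have hlim : ∀ a : SpaceTime n, Tendsto (fun τ : ℝ => χ (τ • a)) (𝓝[>] 0) (𝓝 p) := fun a => by
    simpa [hχ0] using (hcurve a).continuousAt.tendsto.mono_left nhdsWithin_le_nhds
  have htime : ∀ a : SpaceTime n, HasDerivAt (fun τ : ℝ => χ (τ • a) 0) (a 0) 0 := fun a =>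
    (EuclideanSpace.proj (𝕜 := ℝ) (0 : Fin (n + 1))).hasFDerivAt.comp_hasDerivAt 0 (hcurve a)
  -- The claim for tangent vectors whose curve starts into the slab.
  have key : ∀ a : SpaceTime n, ⟪unitGradient F p, a⟫ = 0 →
      (∀ᶠ τ : ℝ in 𝓝[>] 0, 0 ≤ χ (τ • a) 0 ∧ χ (τ • a) 0 ≤ 1) → fderiv ℝ g p a = 0 := by
    intro a ha hslab
    have hgd : HasDerivAt (fun τ : ℝ => g (χ (τ • a))) (fderiv ℝ g p a) 0 := by
      have hg' : HasFDerivAt g (fderiv ℝ g p) (χ ((0 : ℝ) • a)) := by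
        simpa [hχ0] using hg.hasFDerivAt
      exact hg'.comp_hasDerivAt 0 (hcurve a)
    refine hgd.eq_zero_of_eventually_right ?_ ?_
    · simpa [hχ0] using h0.self_of_nhds hp
    · have hsm : Tendsto (fun τ : ℝ => τ • a) (𝓝[>] 0) (𝓝 0) := by
        have : Continuous (fun τ : ℝ => τ • a) := by fun_prop
        simpa using (this.tendsto 0).mono_left nhdsWithin_le_nhds
      filter_upwards [hslab, hsm.eventually hχF, (hlim a).eventually h0,
        (hlim a).eventually hF.eventually_isDefiningFunctionAt] with τ h1 h2 h3 h4
      exact h3 ((h4 (h2 (by simp [real_inner_smul_right, ha]))).mem_surface h1.1 h1.2)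
  -- A tangent vector `b` with time component `1`.
  obtain ⟨b, hb, hb0⟩ : ∃ b : SpaceTime n, ⟪unitGradient F p, b⟫ = 0 ∧ b 0 = 1 := by
    obtain ⟨i, hi⟩ := hF.spatial_ne_zero
    refine ⟨EuclideanSpace.single 0 1 - (fderiv ℝ F p (EuclideanSpace.single 0 1) /
      fderiv ℝ F p (EuclideanSpace.single i.succ 1)) • EuclideanSpace.single i.succ 1, ?_, ?_⟩
    · rw [hF.inner_unitGradient_eq_zero_iff, map_sub, map_smul, smul_eq_mul,
        div_mul_cancel₀ _ hi, sub_self]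
    · simp
  rcases lt_or_ge (p 0) 1 with h1 | h1
  · have hup : ∀ a : SpaceTime n, ⟪unitGradient F p, a⟫ = 0 → 0 < a 0 → fderiv ℝ g p a = 0 := by
      intro a ha hpos
      refine key a ha ?_
      have hlt : ∀ᶠ τ : ℝ in 𝓝[>] 0, χ (τ • a) 0 < 1 :=
        ((continuous_time.tendsto p).comp (hlim a)).eventually_lt_const h1
      filter_upwards [hlt, (htime a).eventually_gt_right hpos] with τ h2 h3
      simp only [zero_smul, hχ0] at h3
      exact ⟨(hp.1.trans_lt h3).le, h2.le⟩
    have h2 := hup (a + (|a 0| + 1) • b) (by simp [inner_add_right, real_inner_smul_right, ha, hb])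
      (by simp [hb0]; linarith [neg_abs_le (a 0)])
    rw [map_add, map_smul, hup b hb (by simp [hb0])] at h2
    simpa using h2
  · have hdown : ∀ a : SpaceTime n, ⟪unitGradient F p, a⟫ = 0 → a 0 < 0 →
        fderiv ℝ g p a = 0 := by
      intro a ha hneg
      refine key a ha ?_
      have hgt : ∀ᶠ τ : ℝ in 𝓝[>] 0, 0 < χ (τ • a) 0 :=
        ((continuous_time.tendsto p).comp (hlim a)).eventually_const_lt (by linarith)
      filter_upwards [hgt, (htime a).neg.eventually_gt_right (by linarith)] with τ h2 h3
      simp only [zero_smul, hχ0, Pi.neg_apply] at h3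
      exact ⟨h2.le, by linarith [hp.2.1]⟩
    have h2 := hdown (a - (|a 0| + 1) • b)
      (by simp [inner_sub_right, real_inner_smul_right, ha, hb])
      (by simp [hb0]; linarith [le_abs_self (a 0)])
    have h3 := hdown (-b) (by simp [hb]) (by simp [hb0])
    rw [map_neg, neg_eq_zero] at h3
    rw [map_sub, map_smul, h3] at h2
    simpa using h2

/-! ### The unit normal -/

/-- All defining functions at a point of the surface give the same outward unit normal. -/
lemma IsDefiningFunctionAt.unitGradient_eq {n : ℕ}
    {S : ℝ → Set (EuclideanSpace ℝ (Fin n))} (hS : IsRegularSweep S) {F G : SpaceTime n → ℝ}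
    {p : SpaceTime n} (hF : IsDefiningFunctionAt S F p) (hG : IsDefiningFunctionAt S G p)
    (hp : p ∈ sweptSurface S) : unitGradient G p = unitGradient F p := by
  have hGd : DifferentiableAt ℝ G p := hG.contDiffAt.differentiableAt (by norm_num)
  have hFd : DifferentiableAt ℝ F p := hF.contDiffAt.differentiableAt (by norm_num)
  set u := unitGradient F p with hu
  have hu1 : ‖u‖ = 1 := hF.norm_unitGradient
  set μ := ⟪gradient G p, u⟫ with hμ
  have hgrad : gradient G p = μ • u := by
    refine ext_inner_right ℝ fun v => ?_
    have ht : ⟪u, v - ⟪u, v⟫ • u⟫ = 0 := by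
      rw [inner_sub_right, real_inner_smul_right, real_inner_self_eq_norm_sq, hu1]; ring
    have h := hF.fderiv_eq_zero_of_tangent hp hGd (hG.eventually_eq_zero hS) ht
    rw [← inner_gradient_left, inner_sub_right, real_inner_smul_right, ← hμ] at h
    rw [real_inner_smul_left]
    linarith
  -- Moving into `{F < 0}` along a spatial line, one stays in the support, so `G` does not increase.
  have hμ0 : 0 ≤ μ := by
    obtain ⟨i, hi⟩ := hF.spatial_ne_zero
    set w : SpaceTime n := (-fderiv ℝ F p (EuclideanSpace.single i.succ 1)) •
      EuclideanSpace.single i.succ 1 with hw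
    have hFw : fderiv ℝ F p w < 0 := by
      rw [hw, map_smul, smul_eq_mul]
      nlinarith [sq_pos_of_ne_zero hi]
    have hGw : fderiv ℝ G p w ≤ 0 := by
      by_contra! hcon
      have hlim : Tendsto (fun τ : ℝ => p + τ • w) (𝓝[>] 0) (𝓝 p) := by
        simpa using (hasDerivAt_add_smul p w 0).continuousAt.tendsto.mono_left nhdsWithin_le_nhds
      have hev : ∀ᶠ τ : ℝ in 𝓝[>] 0, False := by
        filter_upwards [(hGd.hasDerivAt_line w).eventually_gt_right hcon,
          (hFd.hasDerivAt_line w).neg.eventually_gt_right (by linarith),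
          hlim.eventually hF.mem_iff, hlim.eventually hG.mem_iff] with τ h1 h2 h3 h4
        have ht : (p + τ • w) 0 = p 0 := add_smul_spatial_time p i τ _
        simp only [Pi.neg_apply, zero_smul, add_zero, hF.eq_zero, hG.eq_zero] at h1 h2
        have h5 := (h3 (ht ▸ hp.1) (ht ▸ hp.2.1)).2 (by linarith)
        have h6 := (h4 (ht ▸ hp.1) (ht ▸ hp.2.1)).1 h5
        linarith
      exact hev.exists.elim fun _ h => h
    rw [← inner_gradient_left, hgrad, real_inner_smul_left, inner_unitGradient] at hGw
    have : ‖gradient F p‖⁻¹ * fderiv ℝ F p w < 0 :=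
      mul_neg_of_pos_of_neg (inv_pos.2 (norm_pos_iff.2 hF.gradient_ne_zero)) hFw
    by_contra! hcon
    nlinarith
  have hμ1 : μ ≠ 0 := fun h => hG.gradient_ne_zero (by rw [hgrad, h, zero_smul])
  rw [unitGradient, hgrad, norm_smul, hu1, Real.norm_of_nonneg hμ0, smul_smul, mul_one,
    inv_mul_cancel₀ hμ1, one_smul]

/-- The unit normal of the surface is locally the restriction of a `C¹` vector field. -/
lemma IsDefiningFunctionAt.eventually_normal_eq {n : ℕ}
    {S : ℝ → Set (EuclideanSpace ℝ (Fin n))} (hS : IsRegularSweep S)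
    {ν : SpaceTime n → SpaceTime n} (hν : ∀ X ∈ sweptSurface S, IsOutwardUnitNormal S X (ν X))
    {F : SpaceTime n → ℝ} {p : SpaceTime n} (hF : IsDefiningFunctionAt S F p) :
    ∀ᶠ X in 𝓝 p, X ∈ sweptSurface S → ν X = unitGradient F X := by
  filter_upwards [hF.eventually_surface hS] with X h1 hX
  obtain ⟨G, hG, hGν⟩ := hν X hX
  rw [hGν]
  exact (h1 hX).unitGradient_eq hS hG hX

lemma IsDefiningFunctionAt.contDiffAt_gradient {n : ℕ}
    {S : ℝ → Set (EuclideanSpace ℝ (Fin n))} {F : SpaceTime n → ℝ} {p : SpaceTime n}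
    (hF : IsDefiningFunctionAt S F p) : ContDiffAt ℝ 1 (gradient F) p :=
  (InnerProductSpace.toDual ℝ (SpaceTime n)).symm.contDiff.contDiffAt.comp p
    (hF.contDiffAt.fderiv_right (by norm_num))

lemma IsDefiningFunctionAt.contDiffAt_unitGradient {n : ℕ}
    {S : ℝ → Set (EuclideanSpace ℝ (Fin n))} {F : SpaceTime n → ℝ} {p : SpaceTime n}
    (hF : IsDefiningFunctionAt S F p) : ContDiffAt ℝ 1 (unitGradient F) p :=
  ((hF.contDiffAt_gradient.norm ℝ hF.gradient_ne_zero).inv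
    (norm_ne_zero_iff.2 hF.gradient_ne_zero)).smul hF.contDiffAt_gradient

lemma IsDefiningFunctionAt.differentiableAt_unitGradient {n : ℕ}
    {S : ℝ → Set (EuclideanSpace ℝ (Fin n))} {F : SpaceTime n → ℝ} {p : SpaceTime n}
    (hF : IsDefiningFunctionAt S F p) : DifferentiableAt ℝ (unitGradient F) p :=
  hF.contDiffAt_unitGradient.differentiableAt (by norm_num)

/-- The shape operator takes its values in the tangent space. -/
lemma IsDefiningFunctionAt.inner_fderiv_unitGradient_self {n : ℕ}
    {S : ℝ → Set (EuclideanSpace ℝ (Fin n))} {F : SpaceTime n → ℝ} {p : SpaceTime n}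
    (hF : IsDefiningFunctionAt S F p) (a : SpaceTime n) :
    ⟪unitGradient F p, fderiv ℝ (unitGradient F) p a⟫ = 0 := by
  have hne : ∀ᶠ X in 𝓝 p, gradient F X ≠ 0 :=
    hF.contDiffAt_gradient.continuousAt.eventually_ne hF.gradient_ne_zero
  have h1 : (fun X => ⟪unitGradient F X, unitGradient F X⟫) =ᶠ[𝓝 p] fun _ => (1 : ℝ) := by
    filter_upwards [hne] with X hX
    have := norm_ne_zero_iff.2 hX
    rw [real_inner_self_eq_norm_sq, unitGradient, norm_smul]
    simp [this]
  have h2 := fderiv_inner_apply ℝ hF.differentiableAt_unitGradient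
    hF.differentiableAt_unitGradient a
  rw [h1.fderiv_eq, real_inner_comm (unitGradient F p) (fderiv ℝ (unitGradient F) p a)] at h2
  simp only [fderiv_fun_const, Pi.zero_apply, zero_apply] at h2
  linarith

lemma IsDefiningFunctionAt.inner_fderiv_unitGradient {n : ℕ}
    {S : ℝ → Set (EuclideanSpace ℝ (Fin n))} {F : SpaceTime n → ℝ} {p : SpaceTime n}
    (hF : IsDefiningFunctionAt S F p) {a b : SpaceTime n} (hb : ⟪unitGradient F p, b⟫ = 0) :
    ⟪fderiv ℝ (unitGradient F) p a, b⟫ =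
      ‖gradient F p‖⁻¹ * fderiv ℝ (fderiv ℝ F) p a b := by
  have hgd : DifferentiableAt ℝ (gradient F) p :=
    hF.contDiffAt_gradient.differentiableAt (by norm_num)
  have hc : DifferentiableAt ℝ (fun X => ‖gradient F X‖⁻¹) p :=
    (hgd.norm ℝ hF.gradient_ne_zero).inv (norm_ne_zero_iff.2 hF.gradient_ne_zero)
  have h1 : fderiv ℝ (unitGradient F) p a = ‖gradient F p‖⁻¹ • fderiv ℝ (gradient F) p a +
      (fderiv ℝ (fun X => ‖gradient F X‖⁻¹) p a) • gradient F p := by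
    have := fderiv_smul hc hgd
    have h2 : unitGradient F = (fun X => ‖gradient F X‖⁻¹) • gradient F := rfl
    rw [h2, this]
    simp
  have h2 : ⟪fderiv ℝ (gradient F) p a, b⟫ = fderiv ℝ (fderiv ℝ F) p a b := by
    have hd : DifferentiableAt ℝ (fderiv ℝ F) p :=
      (hF.contDiffAt.fderiv_right (m := 1) (by norm_num)).differentiableAt (by norm_num)
    have h := fderiv_inner_apply ℝ hgd (differentiableAt_const b) a
    simp only [inner_gradient_left] at h
    rw [fderiv_clm_apply hd (differentiableAt_const b)] at h
    simpa using h.symm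
  have h3 : ⟪gradient F p, b⟫ = 0 := by
    rw [inner_gradient_left]; exact (hF.inner_unitGradient_eq_zero_iff b).1 hb
  rw [h1, inner_add_left, real_inner_smul_left, real_inner_smul_left, h2, h3, mul_zero, add_zero]

/-- The shape operator is symmetric. -/
lemma IsDefiningFunctionAt.inner_fderiv_unitGradient_comm {n : ℕ}
    {S : ℝ → Set (EuclideanSpace ℝ (Fin n))} {F : SpaceTime n → ℝ} {p : SpaceTime n}
    (hF : IsDefiningFunctionAt S F p) {a b : SpaceTime n} (ha : ⟪unitGradient F p, a⟫ = 0)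
    (hb : ⟪unitGradient F p, b⟫ = 0) :
    ⟪fderiv ℝ (unitGradient F) p a, b⟫ = ⟪fderiv ℝ (unitGradient F) p b, a⟫ := by
  rw [hF.inner_fderiv_unitGradient hb, hF.inner_fderiv_unitGradient ha]
  have : IsSymmSndFDerivAt ℝ F p := hF.contDiffAt.isSymmSndFDerivAt (by simp)
  rw [this.eq a b]

/-! ### First variations -/

/-- The product rule at a zero of the first factor needs only continuity of the second. -/
lemma HasDerivAt.inner_of_eq_zero {E : Type*} [NormedAddCommGroup E] [InnerProductSpace ℝ E]
    {H N : ℝ → E} {H' : E} {x : ℝ} (hH : HasDerivAt H H' x) (h0 : H x = 0)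
    (hN : ContinuousAt N x) : HasDerivAt (fun ε => ⟪H ε, N ε⟫) ⟪H', N x⟫ x := by
  rw [hasDerivAt_iff_tendsto_slope] at hH ⊢
  refine (hH.inner (hN.tendsto.mono_left nhdsWithin_le_nhds)).congr fun ε => ?_
  simp [slope, h0, real_inner_smul_left]

/-- Along a line of constant second variable, the derivative of a family is a partial derivative. -/
lemma hasDerivAt_parameter {E G : Type*} [NormedAddCommGroup E] [NormedSpace ℝ E]
    [NormedAddCommGroup G] [NormedSpace ℝ G] {f : ℝ → E → G} {ε : ℝ} {X : E}
    (hf : DifferentiableAt ℝ (fun q : ℝ × E => f q.1 q.2) (ε, X)) :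
    HasDerivAt (fun δ => f δ X) (fderiv ℝ (fun q : ℝ × E => f q.1 q.2) (ε, X) (1, 0)) ε :=
  hf.hasFDerivAt.comp_hasDerivAt (f := fun δ : ℝ => (δ, X)) ε
    ((hasDerivAt_id ε).prodMk (hasDerivAt_const ε X))

lemma hasFDerivAt_slice {E G : Type*} [NormedAddCommGroup E] [NormedSpace ℝ E]
    [NormedAddCommGroup G] [NormedSpace ℝ G] {f : ℝ → E → G} {ε : ℝ} {X : E}
    (hf : DifferentiableAt ℝ (fun q : ℝ × E => f q.1 q.2) (ε, X)) :
    HasFDerivAt (f ε) ((fderiv ℝ (fun q : ℝ × E => f q.1 q.2) (ε, X)).comp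
      (ContinuousLinearMap.inr ℝ ℝ E)) X :=
  hf.hasFDerivAt.comp (f := fun Y : E => (ε, Y)) X (hasFDerivAt_prodMk_right ε X)

lemma firstVariation_eq {n : ℕ} {G : ℝ → SpaceTime n → SpaceTime n} {X : SpaceTime n}
    (hG : DifferentiableAt ℝ (fun q : ℝ × SpaceTime n => G q.1 q.2) (0, X)) :
    firstVariation G X = fderiv ℝ (fun q : ℝ × SpaceTime n => G q.1 q.2) (0, X) (1, 0) :=
  (hasDerivAt_parameter hG).deriv

lemma hasFDerivAt_firstVariation {n : ℕ} {G : ℝ → SpaceTime n → SpaceTime n} {X : SpaceTime n}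
    (hG : ContDiffAt ℝ 2 (fun q : ℝ × SpaceTime n => G q.1 q.2) (0, X)) :
    HasFDerivAt (firstVariation G)
      (((fderiv ℝ (fderiv ℝ (fun q : ℝ × SpaceTime n => G q.1 q.2)) (0, X)).flip (1, 0)).comp
        (ContinuousLinearMap.inr ℝ ℝ (SpaceTime n))) X := by
  set f := fun q : ℝ × SpaceTime n => G q.1 q.2
  have hd : HasFDerivAt (fderiv ℝ f) (fderiv ℝ (fderiv ℝ f) (0, X)) (0, X) :=
    ((hG.fderiv_right (m := 1) (by norm_num)).differentiableAt (by norm_num)).hasFDerivAt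
  have h1 : HasFDerivAt (fun q => fderiv ℝ f q (1, 0))
      ((fderiv ℝ (fderiv ℝ f) (0, X)).flip (1, 0)) (0, X) := by
    refine (hd.clm_apply (hasFDerivAt_const (1, 0) (0, X))).congr_fderiv ?_
    ext <;> simp
  refine (h1.comp (f := fun Y : SpaceTime n => ((0 : ℝ), Y)) X
    (hasFDerivAt_prodMk_right (0 : ℝ) X)).congr_of_eventuallyEq ?_
  have hc : Tendsto (fun Y : SpaceTime n => ((0 : ℝ), Y)) (𝓝 X) (𝓝 (0, X)) :=
    (Continuous.prodMk_right (0 : ℝ)).tendsto X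
  filter_upwards [hc.eventually (hG.eventually (by simp))] with Y hY
  exact firstVariation_eq (hY.differentiableAt (by norm_num))

/-- The differential of a family of maps, applied to a fixed vector, varies with the parameter by
the differential of the first variation: mixed second derivatives commute. -/
lemma hasDerivAt_fderiv_parameter {n : ℕ} {G : ℝ → SpaceTime n → SpaceTime n} {X : SpaceTime n}
    (hG : ContDiffAt ℝ 2 (fun q : ℝ × SpaceTime n => G q.1 q.2) (0, X)) (w : SpaceTime n) :
    HasDerivAt (fun ε => fderiv ℝ (G ε) X w) (fderiv ℝ (firstVariation G) X w) 0 := by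
  have hY := (hasFDerivAt_firstVariation hG).fderiv
  set f := fun q : ℝ × SpaceTime n => G q.1 q.2
  have hd : HasFDerivAt (fderiv ℝ f) (fderiv ℝ (fderiv ℝ f) (0, X)) (0, X) :=
    ((hG.fderiv_right (m := 1) (by norm_num)).differentiableAt (by norm_num)).hasFDerivAt
  have hsymm : IsSymmSndFDerivAt ℝ f (0, X) := hG.isSymmSndFDerivAt (by simp)
  have h1 : HasDerivAt (fun ε : ℝ => fderiv ℝ f (ε, X))
      (fderiv ℝ (fderiv ℝ f) (0, X) (1, 0)) 0 :=
    hd.comp_hasDerivAt (f := fun ε : ℝ => (ε, X)) 0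
      ((hasDerivAt_id (0 : ℝ)).prodMk (hasDerivAt_const 0 X))
  have h2 := h1.clm_apply (hasDerivAt_const (0 : ℝ) ((0 : ℝ), w))
  have h3 : fderiv ℝ (firstVariation G) X w =
      fderiv ℝ (fderiv ℝ f) (0, X) (1, 0) (0, w) := by
    rw [hY, hsymm.eq]
    rfl
  rw [h3]
  refine HasDerivAt.congr_of_eventuallyEq (by simpa using h2) ?_
  have hc : Tendsto (fun ε : ℝ => (ε, X)) (𝓝 0) (𝓝 (0, X)) :=
    (Continuous.prodMk_left X).tendsto 0
  filter_upwards [hc.eventually (hG.eventually (by simp))] with ε hε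
  rw [(hasFDerivAt_slice (f := G) (hε.differentiableAt (by norm_num))).fderiv]
  rfl

/-- The linearized zero-flux condition: the normal component of the variation of the field is that
of a Lie bracket. The normals `N ε` need not be differentiated: since `W` is tangent, it may be
replaced by `D(Φ ε) W`, which is orthogonal to `N ε`. -/
lemma IsSurfacePerturbation.inner_firstVariation {n : ℕ}
    {S : ℝ → Set (EuclideanSpace ℝ (Fin n))} {ν Y : SpaceTime n → SpaceTime n}
    {W Φ N : ℝ → SpaceTime n → SpaceTime n} (hΦ : IsSurfacePerturbation S ν Φ N)
    {F : SpaceTime n → ℝ} {p : SpaceTime n} (hF : IsDefiningFunctionAt S F p)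
    (hp : p ∈ sweptSurface S) (hνp : ν p = unitGradient F p)
    (hW : ContDiffAt ℝ 1 (fun q : ℝ × SpaceTime n => W q.1 q.2) (0, p))
    (hflux : ⟪W 0 p, ν p⟫ = 0)
    (hlin : HasDerivAt (fun ε : ℝ => ⟪W ε (Φ ε p), N ε p⟫) 0 0) (hY : Y = firstVariation Φ) :
    ⟪firstVariation W p, ν p⟫ =
      ⟪fderiv ℝ Y p (W 0 p), ν p⟫ - ⟪fderiv ℝ (W 0) p (Y p), ν p⟫ := by
  subst hY
  set w := W 0 p with hw
  have hΦ2 := hΦ.contDiffAt p hp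
  have hΦ1 : DifferentiableAt ℝ (fun q : ℝ × SpaceTime n => Φ q.1 q.2) (0, p) :=
    hΦ2.differentiableAt (by norm_num)
  have hW1 := hW.differentiableAt (by norm_num)
  have hΦ0 : Φ 0 p = p := hΦ.map_zero p hp
  have hA0 : fderiv ℝ (Φ 0) p w = w := by
    have hd : DifferentiableAt ℝ (Φ 0) p := (hasFDerivAt_slice hΦ1).differentiableAt
    have h := hF.fderiv_eq_zero_of_tangent hp (g := fun X => Φ 0 X - X)
      (hd.sub differentiableAt_id)
      (Eventually.of_forall fun X hX => by rw [hΦ.map_zero X hX, sub_self])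
      (a := w) (by rw [← hνp, real_inner_comm]; exact hflux)
    have h2 : fderiv ℝ (fun X => Φ 0 X - X) p = fderiv ℝ (Φ 0) p - ContinuousLinearMap.id ℝ _ :=
      (hd.hasFDerivAt.sub (hasFDerivAt_id p)).fderiv
    rw [h2] at h
    simpa [sub_eq_zero] using h
  have hG : HasDerivAt (fun ε => W ε (Φ ε p))
      (firstVariation W p + fderiv ℝ (W 0) p (firstVariation Φ p)) 0 := by
    have hW' : HasFDerivAt (fun q : ℝ × SpaceTime n => W q.1 q.2)
        (fderiv ℝ (fun q : ℝ × SpaceTime n => W q.1 q.2) (0, p)) (0, Φ 0 p) := by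
      rw [hΦ0]; exact hW1.hasFDerivAt
    have hΦd : HasDerivAt (fun ε => Φ ε p) (firstVariation Φ p) 0 := by
      rw [firstVariation_eq hΦ1]; exact hasDerivAt_parameter hΦ1
    have h := hW'.comp_hasDerivAt (f := fun ε : ℝ => (ε, Φ ε p)) 0
      ((hasDerivAt_id (0 : ℝ)).prodMk hΦd)
    have hval : firstVariation W p + fderiv ℝ (W 0) p (firstVariation Φ p) =
        fderiv ℝ (fun q : ℝ × SpaceTime n => W q.1 q.2) (0, p) (1, firstVariation Φ p) := by
      rw [firstVariation_eq hW1, (hasFDerivAt_slice hW1).fderiv]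
      simp [← map_add]
    rw [hval]
    exact h
  have hH := (hG.sub (hasDerivAt_fderiv_parameter hΦ2 w)).inner_of_eq_zero
    (by simp only [Pi.sub_apply, hΦ0, hA0, ← hw, sub_self]) (hΦ.normal_continuousAt p hp)
  have heq : (fun ε : ℝ => ⟪W ε (Φ ε p), N ε p⟫) =ᶠ[𝓝 0]
      fun ε => ⟪((fun ε => W ε (Φ ε p)) - fun ε => fderiv ℝ (Φ ε) p w) ε, N ε p⟫ := by
    filter_upwards [hΦ.normal_orthogonal p hp] with ε hε
    have h := hε w (by rw [real_inner_comm]; exact hflux)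
    rw [Pi.sub_apply, inner_sub_left, real_inner_comm (N ε p) (fderiv ℝ (Φ ε) p w), h, sub_zero]
  have h0 := (hlin.congr_of_eventuallyEq heq.symm).unique hH
  rw [hΦ.normal_zero p hp, inner_sub_left, inner_add_left] at h0
  linarith

/-- The linearized zero-flux condition as a transport equation on the surface for the normal
displacement `⟪δΦ, ν⟫`. The tangential part of the displacement drops out because the shape
operator is symmetric. -/
lemma IsSurfacePerturbation.inner_firstVariation_eq_transport {n : ℕ}
    {S : ℝ → Set (EuclideanSpace ℝ (Fin n))} (hS : IsRegularSweep S)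
    {ν : SpaceTime n → SpaceTime n} (hν : ∀ X ∈ sweptSurface S, IsOutwardUnitNormal S X (ν X))
    {W Φ N : ℝ → SpaceTime n → SpaceTime n} (hΦ : IsSurfacePerturbation S ν Φ N)
    {F : SpaceTime n → ℝ} {p : SpaceTime n} (hF : IsDefiningFunctionAt S F p)
    (hp : p ∈ sweptSurface S)
    (hW : ContDiffAt ℝ 1 (fun q : ℝ × SpaceTime n => W q.1 q.2) (0, p))
    (hflux : ∀ X ∈ sweptSurface S, ⟪W 0 X, ν X⟫ = 0)
    (hlin : HasDerivAt (fun ε : ℝ => ⟪W ε (Φ ε p), N ε p⟫) 0 0) :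
    ⟪firstVariation W p, ν p⟫ =
      fderiv ℝ (fun X => ⟪firstVariation Φ X, unitGradient F X⟫) p (W 0 p) -
        ⟪firstVariation Φ p, ν p⟫ * ⟪fderiv ℝ (W 0) p (ν p), ν p⟫ := by
  have hev := hF.eventually_normal_eq hS hν
  have hνp : ν p = unitGradient F p := hev.self_of_nhds hp
  have hW0 : DifferentiableAt ℝ (W 0) p :=
    (hasFDerivAt_slice (hW.differentiableAt (by norm_num))).differentiableAt
  have hYd := (hasFDerivAt_firstVariation (hΦ.contDiffAt p hp)).differentiableAt
  have hu := hF.differentiableAt_unitGradient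
  have hwt : ⟪unitGradient F p, W 0 p⟫ = 0 := by
    rw [← hνp, real_inner_comm]; exact hflux p hp
  -- Differentiating `⟪W, ν⟫ = 0` along a tangent vector.
  have htan : ∀ a, ⟪unitGradient F p, a⟫ = 0 →
      ⟪fderiv ℝ (W 0) p a, unitGradient F p⟫ = -⟪fderiv ℝ (unitGradient F) p a, W 0 p⟫ := by
    intro a ha
    have h := hF.fderiv_eq_zero_of_tangent hp (g := fun X => ⟪W 0 X, unitGradient F X⟫)
      (hW0.inner ℝ hu) (hev.mono fun X hX hXS => by rw [← hX hXS]; exact hflux X hXS) ha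
    rw [fderiv_inner_apply ℝ hW0 hu, real_inner_comm] at h
    linarith
  rw [hΦ.inner_firstVariation hF hp hνp hW (hflux p hp) hlin rfl, hνp,
    fderiv_inner_apply ℝ hYd hu]
  set u := unitGradient F p with hudef
  set y := firstVariation Φ p with hy
  set a := y - ⟪y, u⟫ • u with ha
  have hut : ⟪u, a⟫ = 0 := by
    rw [ha, inner_sub_right, real_inner_smul_right, real_inner_self_eq_norm_sq,
      hF.norm_unitGradient, real_inner_comm]
    ring
  have hyd : y = a + ⟪y, u⟫ • u := by rw [ha]; abel
  have h1 : ⟪fderiv ℝ (W 0) p y, u⟫ =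
      ⟪fderiv ℝ (W 0) p a, u⟫ + ⟪y, u⟫ * ⟪fderiv ℝ (W 0) p u, u⟫ := by
    conv_lhs => rw [hyd]
    rw [map_add, map_smul, inner_add_left, real_inner_smul_left]
  have h2 : ⟪y, fderiv ℝ (unitGradient F) p (W 0 p)⟫ =
      ⟪fderiv ℝ (unitGradient F) p (W 0 p), a⟫ := by
    conv_lhs => rw [hyd]
    rw [inner_add_left, real_inner_smul_left, hF.inner_fderiv_unitGradient_self, mul_zero,
      add_zero, real_inner_comm]
  rw [h1, h2, htan a hut, hF.inner_fderiv_unitGradient_comm hwt hut]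
  ring

/-! ### Orthonormal frames along the surface -/

lemma Orthonormal.exists_orthonormalBasis_cons {n : ℕ} {u : SpaceTime n} {e : Fin n → SpaceTime n}
    (he : Orthonormal ℝ e) (hu : ‖u‖ = 1) (hue : ∀ i, ⟪u, e i⟫ = 0) :
    ∃ b : OrthonormalBasis (Fin (n + 1)) ℝ (SpaceTime n), b 0 = u ∧ ∀ i : Fin n, b i.succ = e i := by
  have hv : Orthonormal ℝ (Fin.cons u e : Fin (n + 1) → SpaceTime n) := by
    refine ⟨fun i => ?_, fun i j hij => ?_⟩
    · refine Fin.cases ?_ (fun k => ?_) i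
      · simpa using hu
      · simpa using he.1 k
    · induction i using Fin.cases with
      | zero =>
        induction j using Fin.cases with
        | zero => exact absurd rfl hij
        | succ l => simpa using hue l
      | succ k =>
        induction j using Fin.cases with
        | zero => simpa [real_inner_comm] using hue k
        | succ l => simpa using he.2 (fun h => hij (congrArg Fin.succ h))
  obtain ⟨b, hb⟩ := Orthonormal.exists_orthonormalBasis_extension_of_card_eq (𝕜 := ℝ)
    (E := SpaceTime n) (ι := Fin (n + 1)) (by simp) (s := Set.univ)
    (hv.comp (fun i : ↥(Set.univ : Set (Fin (n + 1))) => (i : Fin (n + 1))) Subtype.val_injective)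
  exact ⟨b, by simpa using hb 0 trivial, fun i => by simpa using hb i.succ trivial⟩

lemma Orthonormal.eq_sum_inner_smul_of_orthogonal {n : ℕ} {u w : SpaceTime n}
    {e : Fin n → SpaceTime n} (he : Orthonormal ℝ e) (hu : ‖u‖ = 1) (hue : ∀ i, ⟪u, e i⟫ = 0)
    (hw : ⟪u, w⟫ = 0) : w = ∑ i, ⟪w, e i⟫ • e i := by
  obtain ⟨b, hb0, hbs⟩ := he.exists_orthonormalBasis_cons hu hue
  have h := b.sum_repr' w
  rw [Fin.sum_univ_succ, hb0, hw, zero_smul, zero_add] at h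
  simp only [hbs] at h
  simpa only [real_inner_comm] using h.symm

lemma Orthonormal.divergence_eq {n : ℕ} {u : SpaceTime n} {e : Fin n → SpaceTime n}
    (he : Orthonormal ℝ e) (hu : ‖u‖ = 1) (hue : ∀ i, ⟪u, e i⟫ = 0)
    (W : SpaceTime n → SpaceTime n) (X : SpaceTime n) :
    divergence W X = ⟪fderiv ℝ W X u, u⟫ + ∑ i, ⟪fderiv ℝ W X (e i), e i⟫ := by
  obtain ⟨b, hb0, hbs⟩ := he.exists_orthonormalBasis_cons hu hue
  have h1 := LinearMap.trace_eq_sum_inner (fderiv ℝ W X : SpaceTime n →ₗ[ℝ] SpaceTime n) b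
  rw [LinearMap.trace_eq_sum_inner _ (EuclideanSpace.basisFun (Fin (n + 1)) ℝ),
    Fin.sum_univ_succ (fun i => inner ℝ (b i) _), hb0] at h1
  simp only [hbs, ContinuousLinearMap.coe_coe, EuclideanSpace.basisFun_apply,
    EuclideanSpace.inner_single_left, map_one, one_mul] at h1
  rw [divergence, h1, real_inner_comm]
  congr 1
  exact Finset.sum_congr rfl fun i _ => real_inner_comm _ _

/-! ### Parametrizations -/

lemma ContDiffAt.eventually_coordTangent_eq {n : ℕ} {x : (Fin n → ℝ) → SpaceTime n}
    {s₀ : Fin n → ℝ} (hx : ContDiffAt ℝ 2 x s₀) (i : Fin n) :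
    ∀ᶠ s in 𝓝 s₀, coordTangent x i s = fderiv ℝ x s (coordDir i) := by
  filter_upwards [hx.eventually (by simp)] with s hs
  exact (hs.differentiableAt (by norm_num)).lineDeriv_eq_fderiv

lemma ContDiffAt.differentiableAt_coordTangent {n : ℕ} {x : (Fin n → ℝ) → SpaceTime n}
    {s₀ : Fin n → ℝ} (hx : ContDiffAt ℝ 2 x s₀) (i : Fin n) :
    DifferentiableAt ℝ (coordTangent x i) s₀ := by
  have h : DifferentiableAt ℝ (fun s => fderiv ℝ x s (coordDir i)) s₀ :=
    ((hx.fderiv_right (m := 1) (by norm_num)).differentiableAt (by norm_num)).clm_apply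
      (differentiableAt_const _)
  exact h.congr_of_eventuallyEq (hx.eventually_coordTangent_eq i)

lemma ContDiffAt.differentiableAt_unitTangent {n : ℕ} {x : (Fin n → ℝ) → SpaceTime n}
    {s₀ : Fin n → ℝ} (hx : ContDiffAt ℝ 2 x s₀) {i : Fin n} (hi : coordTangent x i s₀ ≠ 0) :
    DifferentiableAt ℝ (unitTangent x i) s₀ :=
  (((hx.differentiableAt_coordTangent i).norm ℝ hi).inv (norm_ne_zero_iff.2 hi)).smul
    (hx.differentiableAt_coordTangent i)

lemma unitTangent_eq_coordTangent {n : ℕ} {x : (Fin n → ℝ) → SpaceTime n} {i : Fin n}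
    {s : Fin n → ℝ} (h : ‖coordTangent x i s‖ = 1) : unitTangent x i s = coordTangent x i s := by
  rw [unitTangent, h, inv_one, one_smul]

/-- Normalizing a curve does not change its velocity at a point where the curve has unit length and
its velocity is orthogonal to it. -/
lemma HasDerivAt.normalize {E : Type*} [NormedAddCommGroup E] [InnerProductSpace ℝ E]
    {f : ℝ → E} {f' : E} {x : ℝ} (hf : HasDerivAt f f' x) (h1 : ‖f x‖ = 1)
    (h0 : ⟪f x, f'⟫ = 0) : HasDerivAt (fun τ => ‖f τ‖⁻¹ • f τ) f' x := by
  have hn : HasDerivAt (fun τ => ‖f τ‖) 0 x := by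
    have h := hf.norm_sq.sqrt (by simp [h1])
    simpa [h0] using h
  have h : HasDerivAt (fun τ => ‖f τ‖⁻¹ • f τ) (‖f x‖⁻¹ • f' + (-0 / ‖f x‖ ^ 2) • f x) x :=
    (hn.inv (by simp [h1])).smul hf
  simpa [h1] using h

/-- Principal coordinates exist: in the chart of `IsDefiningFunctionAt.exists_chart` take linear
coordinates with respect to an orthonormal eigenbasis of the shape operator. -/
lemma IsDefiningFunctionAt.exists_principalCoordinates {n : ℕ}
    {S : ℝ → Set (EuclideanSpace ℝ (Fin n))} (hS : IsRegularSweep S)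
    {ν : SpaceTime n → SpaceTime n} (hν : ∀ X ∈ sweptSurface S, IsOutwardUnitNormal S X (ν X))
    {F : SpaceTime n → ℝ} {p : SpaceTime n} (hF : IsDefiningFunctionAt S F p)
    (hp0 : 0 < p 0) (hp1 : p 0 < 1) :
    ∃ (x : (Fin n → ℝ) → SpaceTime n) (s₀ : Fin n → ℝ), IsPrincipalCoordinates S ν x s₀ p := by
  set u := unitGradient F p with hu
  have hu1 : ‖u‖ = 1 := hF.norm_unitGradient
  -- The orthonormal eigenbasis.
  obtain ⟨e, μ, he, hue, heig⟩ : ∃ (e : Fin n → SpaceTime n) (μ : Fin n → ℝ), Orthonormal ℝ e ∧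
      (∀ i, ⟪u, e i⟫ = 0) ∧ ∀ i, fderiv ℝ (unitGradient F) p (e i) = μ i • e i := by
    let K : Submodule ℝ (SpaceTime n) := (ℝ ∙ u)ᗮ
    have hK : ∀ v : SpaceTime n, v ∈ K ↔ ⟪u, v⟫ = 0 := fun v =>
      Submodule.mem_orthogonal_singleton_iff_inner_right
    let T : K →ₗ[ℝ] K := ((fderiv ℝ (unitGradient F) p : SpaceTime n →ₗ[ℝ] SpaceTime n).comp
      K.subtype).codRestrict K fun v => (hK _).2 (hF.inner_fderiv_unitGradient_self _)
    have hT : T.IsSymmetric := fun v w => by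
      have h := hF.inner_fderiv_unitGradient_comm ((hK _).1 v.2) ((hK _).1 w.2)
      rw [real_inner_comm (v : SpaceTime n)] at h
      exact h
    have : Fact (Module.finrank ℝ (SpaceTime n) = n + 1) := ⟨by simp⟩
    have hfin : Module.finrank ℝ K = n :=
      Submodule.finrank_orthogonal_span_singleton (norm_ne_zero_iff.1 (by rw [hu1]; norm_num))
    let b := hT.eigenvectorBasis hfin
    refine ⟨fun i => (b i : SpaceTime n), hT.eigenvalues hfin,
      b.orthonormal.comp_linearIsometry K.subtypeₗᵢ, fun i => (hK _).1 (b i).2, fun i => ?_⟩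
    exact congrArg Subtype.val (hT.apply_eigenvectorBasis hfin i)
  obtain ⟨χ, hχ2, hχ0, hχ', hχF, hχa⟩ := hF.exists_chart
  let L : (Fin n → ℝ) →L[ℝ] SpaceTime n :=
    ∑ i, (ContinuousLinearMap.proj (R := ℝ) (φ := fun _ : Fin n => ℝ) i).smulRight (e i)
  have hLs : ∀ s, L s = ∑ i, s i • e i := fun s => by simp [L]
  have hLd : ∀ i, L (coordDir i) = e i := fun i => by
    rw [hLs, Finset.sum_eq_single i]
    · simp [coordDir]
    · intro j _ hj; simp [coordDir, hj]
    · simp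
  have hLu : ∀ s, ⟪u, L s⟫ = 0 := fun s => by
    simp [hLs, inner_sum, real_inner_smul_right, hue]
  have hLe : ∀ s k, ⟪L s, e k⟫ = s k := fun s k => by
    rw [hLs]; simpa using he.inner_left_fintype s k
  set x : (Fin n → ℝ) → SpaceTime n := fun s => χ (L s) with hx
  have hx0 : x 0 = p := by simp [hx, hχ0]
  have hx2 : ContDiffAt ℝ 2 x 0 := by
    have h : ContDiffAt ℝ 2 χ (L 0) := by simpa using hχ2
    exact h.comp (0 : Fin n → ℝ) L.contDiff.contDiffAt
  have hx' : HasFDerivAt x L 0 := by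
    have h : HasFDerivAt χ (ContinuousLinearMap.id ℝ (SpaceTime n)) (L 0) := by simpa using hχ'
    have h2 := h.comp (0 : Fin n → ℝ) L.hasFDerivAt
    rw [ContinuousLinearMap.id_comp] at h2
    exact h2
  have hxlim : Tendsto x (𝓝 0) (𝓝 p) := hx0 ▸ hx2.continuousAt.tendsto
  have hLlim : Tendsto L (𝓝 0) (𝓝 0) := by simpa using L.continuous.tendsto 0
  have htan : ∀ i, coordTangent x i 0 = e i := fun i => by
    rw [(hx2.eventually_coordTangent_eq i).self_of_nhds, hx'.fderiv, hLd]
  have hunit : ∀ i, unitTangent x i 0 = e i := fun i => by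
    rw [unitTangent_eq_coordTangent (by rw [htan, he.1 i]), htan]
  have hmem : ∀ᶠ s in 𝓝 (0 : Fin n → ℝ), x s ∈ sweptSurface S := by
    have ht := (continuous_time.tendsto p).comp hxlim
    filter_upwards [ht.eventually_const_lt hp0, ht.eventually_lt_const hp1,
      hLlim.eventually hχF, hxlim.eventually hF.eventually_isDefiningFunctionAt] with s h1 h2 h3 h4
    exact (h4 (h3 (hLu s))).mem_surface h1.le h2.le
  refine ⟨x, 0, hx2, hx0, hmem, ?_, ⟨fun i => -μ i, fun i => ?_⟩, fun i j k => ?_⟩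
  · simpa only [htan] using he
  · rw [hunit, neg_neg, ← heig]
    have h : HasFDerivAt (unitGradient F) (fderiv ℝ (unitGradient F) p) (x 0) := by
      rw [hx0]; exact hF.differentiableAt_unitGradient.hasFDerivAt
    have h2 := (h.comp (0 : Fin n → ℝ) hx').hasLineDerivAt (coordDir i)
    rw [ContinuousLinearMap.comp_apply, hLd] at h2
    refine h2.congr_of_eventuallyEq ?_
    filter_upwards [hmem, hxlim.eventually (hF.eventually_normal_eq hS hν)] with s h3 h4
    exact h4 h3
  · have hcd := (hx2.differentiableAt_coordTangent j)
    -- The tangential components of the coordinate tangent vectors are constant near the origin.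
    have hconst : ∀ k, (fun s => ⟪coordTangent x j s, e k⟫) =ᶠ[𝓝 0]
        fun _ => coordDir j k := by
      intro k
      have hev : ∀ᶠ s in 𝓝 (0 : Fin n → ℝ), ⟪x s, e k⟫ = ⟪p, e k⟫ + s k := by
        filter_upwards [hLlim.eventually hχa] with s hs
        rw [hx, hs (e k) (hue k), hLe]
      filter_upwards [hev.eventually_nhds, hx2.eventually_coordTangent_eq j,
        hx2.eventually (by simp)] with s h1 h2 h3
      have h4 := fderiv_inner_apply ℝ (h3.differentiableAt (by norm_num))
        (differentiableAt_const (e k)) (coordDir j)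
      have h5 : HasFDerivAt (fun s : Fin n → ℝ => ⟪p, e k⟫ + s k)
          (ContinuousLinearMap.proj (R := ℝ) (φ := fun _ : Fin n => ℝ) k) s :=
        (ContinuousLinearMap.proj (R := ℝ) (φ := fun _ : Fin n => ℝ) k).hasFDerivAt.const_add _
      rw [EventuallyEq.fderiv_eq (h1 : _ =ᶠ[𝓝 s] _), h5.fderiv] at h4
      rw [h2]
      simpa using h4.symm
    have horth : ∀ k, ⟪fderiv ℝ (coordTangent x j) 0 (coordDir i), e k⟫ = 0 := by
      intro k
      have h := fderiv_inner_apply ℝ hcd (differentiableAt_const (e k)) (coordDir i)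
      rw [(hconst k).fderiv_eq] at h
      simpa using h.symm
    have hline : HasLineDerivAt ℝ (unitTangent x j)
        (fderiv ℝ (coordTangent x j) 0 (coordDir i)) 0 (coordDir i) := by
      refine HasDerivAt.normalize (hcd.hasDerivAt_line (coordDir i)) ?_ ?_
      · simp [htan, he.1 j]
      · simpa [htan, real_inner_comm] using horth j
    rw [hline.lineDeriv, hunit, horth]

/-- In principal coordinates the right-hand side of the transport equation is a divergence: the
terms with derivatives of the unit tangent vectors vanish, and the derivative of the field in the
normal direction is minus the trace of its tangential derivatives, as its divergence is zero. -/
lemma IsPrincipalCoordinates.transport_eq_sum_lineDeriv {n : ℕ}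
    {S : ℝ → Set (EuclideanSpace ℝ (Fin n))} (hS : IsRegularSweep S)
    {ν : SpaceTime n → SpaceTime n} (hν : ∀ X ∈ sweptSurface S, IsOutwardUnitNormal S X (ν X))
    {F : SpaceTime n → ℝ} {p : SpaceTime n} (hF : IsDefiningFunctionAt S F p)
    {w Y : SpaceTime n → SpaceTime n} (hw : DifferentiableAt ℝ w p) (hY : DifferentiableAt ℝ Y p)
    (hdiv : divergence w p = 0) (hwν : ⟪w p, ν p⟫ = 0)
    {x : (Fin n → ℝ) → SpaceTime n} {s₀ : Fin n → ℝ} (hx : IsPrincipalCoordinates S ν x s₀ p) :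
    (∀ i : Fin n, LineDifferentiableAt ℝ
      (fun s => ⟪w (x s), unitTangent x i s⟫ * ⟪Y (x s), ν (x s)⟫) s₀ (coordDir i)) ∧
    fderiv ℝ (fun X => ⟪Y X, unitGradient F X⟫) p (w p) - ⟪Y p, ν p⟫ * ⟪fderiv ℝ w p (ν p), ν p⟫ =
      ∑ i : Fin n, lineDeriv ℝ
        (fun s => ⟪w (x s), unitTangent x i s⟫ * ⟪Y (x s), ν (x s)⟫) s₀ (coordDir i) := by
  have hx2 := hx.contDiffAt
  have hxb := hx.base
  have hxlim : Tendsto x (𝓝 s₀) (𝓝 p) := hxb ▸ hx2.continuousAt.tendsto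
  have hp : p ∈ sweptSurface S := hxb ▸ hx.mem_surface.self_of_nhds
  have hev := hF.eventually_normal_eq hS hν
  have hνp : ν p = unitGradient F p := hev.self_of_nhds hp
  have hxd : DifferentiableAt ℝ x s₀ := hx2.differentiableAt (by norm_num)
  set e : Fin n → SpaceTime n := fun i => coordTangent x i s₀ with he_def
  have he : Orthonormal ℝ e := hx.orthonormal
  have hed : ∀ i, e i = fderiv ℝ x s₀ (coordDir i) := fun i =>
    (hx2.eventually_coordTangent_eq i).self_of_nhds
  have hunit : ∀ i, unitTangent x i s₀ = e i := fun i => unitTangent_eq_coordTangent (he.1 i)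
  have hu1 : ‖ν p‖ = 1 := hνp ▸ hF.norm_unitGradient
  have hue : ∀ i, ⟪ν p, e i⟫ = 0 := by
    intro i
    have h0 : F ∘ x =ᶠ[𝓝 s₀] fun _ => 0 := by
      filter_upwards [hx.mem_surface, hxlim.eventually (hF.eventually_eq_zero hS)] with s h1 h2
      exact h2 h1
    have hFd : HasFDerivAt F (fderiv ℝ F p) (x s₀) := by
      rw [hxb]; exact (hF.contDiffAt.differentiableAt (by norm_num)).hasFDerivAt
    have h1 := (hFd.comp s₀ hxd.hasFDerivAt).fderiv
    rw [h0.fderiv_eq, fderiv_fun_const] at h1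
    rw [hνp, hF.inner_unitGradient_eq_zero_iff, hed]
    exact (DFunLike.congr_fun h1 (coordDir i)).symm
  have hwp : w p = ∑ i, ⟪w p, e i⟫ • e i :=
    he.eq_sum_inner_smul_of_orthogonal hu1 hue (by rw [real_inner_comm]; exact hwν)
  have hyd : DifferentiableAt ℝ (fun X => ⟪Y X, unitGradient F X⟫) p :=
    hY.inner ℝ hF.differentiableAt_unitGradient
  have hmain : ∀ i, HasLineDerivAt ℝ
      (fun s => ⟪w (x s), unitTangent x i s⟫ * ⟪Y (x s), ν (x s)⟫)
      (⟪fderiv ℝ w p (e i), e i⟫ * ⟪Y p, ν p⟫ +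
        ⟪w p, e i⟫ * fderiv ℝ (fun X => ⟪Y X, unitGradient F X⟫) p (e i)) s₀ (coordDir i) := by
    intro i
    have hTd : DifferentiableAt ℝ (unitTangent x i) s₀ :=
      hx2.differentiableAt_unitTangent (norm_ne_zero_iff.1 (by rw [he.1 i]; norm_num))
    -- The derivative of the unit tangent vector is orthogonal to the field.
    have hT0 : ⟪w p, fderiv ℝ (unitTangent x i) s₀ (coordDir i)⟫ = 0 := by
      rw [hwp, sum_inner]
      refine Finset.sum_eq_zero fun k _ => ?_
      have h := hx.tangential_eq_zero i i k
      rw [hunit, hTd.lineDeriv_eq_fderiv, real_inner_comm] at h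
      rw [real_inner_smul_left, h, mul_zero]
    have hwx : HasFDerivAt (fun s => w (x s)) ((fderiv ℝ w p).comp (fderiv ℝ x s₀)) s₀ := by
      have h : HasFDerivAt w (fderiv ℝ w p) (x s₀) := by rw [hxb]; exact hw.hasFDerivAt
      exact h.comp s₀ hxd.hasFDerivAt
    have hyx : HasFDerivAt (fun s => ⟪Y (x s), unitGradient F (x s)⟫)
        ((fderiv ℝ (fun X => ⟪Y X, unitGradient F X⟫) p).comp (fderiv ℝ x s₀)) s₀ := by
      have h : HasFDerivAt (fun X => ⟪Y X, unitGradient F X⟫)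
        (fderiv ℝ (fun X => ⟪Y X, unitGradient F X⟫) p) (x s₀) := by rw [hxb]; exact hyd.hasFDerivAt
      exact h.comp s₀ hxd.hasFDerivAt
    have h := ((hwx.inner ℝ hTd.hasFDerivAt).mul hyx).hasLineDerivAt (coordDir i)
    have hval : (⟪w (x s₀), unitTangent x i s₀⟫ •
        ((fderiv ℝ (fun X => ⟪Y X, unitGradient F X⟫) p).comp (fderiv ℝ x s₀)) +
        ⟪Y (x s₀), unitGradient F (x s₀)⟫ • ((fderivInnerCLM ℝ (w (x s₀), unitTangent x i s₀)).comp
          (((fderiv ℝ w p).comp (fderiv ℝ x s₀)).prod (fderiv ℝ (unitTangent x i) s₀))))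
          (coordDir i) = ⟪fderiv ℝ w p (e i), e i⟫ * ⟪Y p, ν p⟫ +
        ⟪w p, e i⟫ * fderiv ℝ (fun X => ⟪Y X, unitGradient F X⟫) p (e i) := by
      simp [hxb, hunit, ← hed, hT0, ← hνp, fderivInnerCLM_apply]
      ring
    rw [hval] at h
    refine h.congr_of_eventuallyEq ?_
    filter_upwards [hx.mem_surface, hxlim.eventually hev] with s h3 h4
    simp only [Pi.mul_apply, h4 h3]
  refine ⟨fun i => (hmain i).lineDifferentiableAt, ?_⟩
  rw [Finset.sum_congr rfl fun i _ => (hmain i).lineDeriv, Finset.sum_add_distrib,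
    ← Finset.sum_mul]
  have htr := he.divergence_eq hu1 hue w p
  rw [hdiv] at htr
  have hsum : ∑ i, ⟪fderiv ℝ w p (e i), e i⟫ = -⟪fderiv ℝ w p (ν p), ν p⟫ := by linarith
  have hD : fderiv ℝ (fun X => ⟪Y X, unitGradient F X⟫) p (w p) =
      ∑ i, ⟪w p, e i⟫ * fderiv ℝ (fun X => ⟪Y X, unitGradient F X⟫) p (e i) := by
    conv_lhs => rw [hwp, map_sum]
    simp only [map_smul, smul_eq_mul]
  rw [hsum, hD]
  ring

/-! ### The transport equation has no nonzero solution vanishing at the ends -/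

/-- The critical point condition on the surface, for a function `f` given on the surface only and
any differentiable extension `g` of it. -/
lemma IsDefiningFunctionAt.fderiv_eq_zero_of_isMaxOn {n : ℕ}
    {S : ℝ → Set (EuclideanSpace ℝ (Fin n))} {F : SpaceTime n → ℝ} {p : SpaceTime n}
    (hF : IsDefiningFunctionAt S F p) (hp0 : 0 < p 0) (hp1 : p 0 < 1) {f g : SpaceTime n → ℝ}
    (hmax : IsMaxOn f (sweptSurface S) p) (hg : DifferentiableAt ℝ g p)
    (hfg : ∀ᶠ X in 𝓝 p, X ∈ sweptSurface S → f X = g X) {a : SpaceTime n}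
    (ha : ⟪unitGradient F p, a⟫ = 0) : fderiv ℝ g p a = 0 := by
  obtain ⟨χ, -, hχ0, hχ', hχF, -⟩ := hF.exists_chart
  have hcurve : HasDerivAt (fun τ : ℝ => χ (τ • a)) a 0 := by
    simpa [HasLineDerivAt] using hχ'.hasLineDerivAt a
  have hlim : Tendsto (fun τ : ℝ => χ (τ • a)) (𝓝 0) (𝓝 p) := by
    simpa [hχ0] using hcurve.continuousAt.tendsto
  have hg' : HasFDerivAt g (fderiv ℝ g p) (χ ((0 : ℝ) • a)) := by
    simpa [hχ0] using hg.hasFDerivAt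
  have hp : p ∈ sweptSurface S := hF.mem_surface hp0.le hp1.le
  refine IsLocalMax.hasDerivAt_eq_zero (a := 0) ?_ (hg'.comp_hasDerivAt 0 hcurve)
  have hsm : Tendsto (fun τ : ℝ => τ • a) (𝓝 0) (𝓝 0) := by
    have : Continuous (fun τ : ℝ => τ • a) := by fun_prop
    simpa using this.tendsto 0
  have ht := (continuous_time.tendsto p).comp hlim
  filter_upwards [ht.eventually_const_lt hp0, ht.eventually_lt_const hp1, hsm.eventually hχF,
    hlim.eventually hF.eventually_isDefiningFunctionAt, hlim.eventually hfg] with τ h1 h2 h3 h4 h5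
  have hm := (h4 (h3 (by simp [real_inner_smul_right, ha]))).mem_surface h1.le h2.le
  have h6 : f (χ (τ • a)) ≤ f p := hmax hm
  rw [h5 hm, hfg.self_of_nhds hp] at h6
  simpa [hχ0] using h6

/-- A maximum principle. If the density is positive, then for large `l` the weight `exp (-l t)`
makes the zero-order coefficient of the transport equation for `exp (-l t) y` negative, so the
square of that function has no positive maximum over the compact surface at a time strictly between
`0` and `1`. -/
lemma IsRegularSweep.eq_zero_of_transport {n : ℕ}
    {S : ℝ → Set (EuclideanSpace ℝ (Fin n))} (hS : IsRegularSweep S)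
    {ν : SpaceTime n → SpaceTime n} (hν : ∀ X ∈ sweptSurface S, IsOutwardUnitNormal S X (ν X))
    {w Y : SpaceTime n → SpaceTime n} (hw : ∀ X ∈ sweptSurface S, ContDiffAt ℝ 1 w X)
    (hY : ∀ X ∈ sweptSurface S, DifferentiableAt ℝ Y X)
    (hwν : ∀ X ∈ sweptSurface S, ⟪w X, ν X⟫ = 0)
    (hpos : ∀ X ∈ sweptSurface S, 0 < w X 0)
    (hends : ∀ X ∈ sweptSurface S, X 0 = 0 ∨ X 0 = 1 → ⟪Y X, ν X⟫ = 0)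
    (htrans : ∀ X ∈ sweptSurface S, ∀ F : SpaceTime n → ℝ, IsDefiningFunctionAt S F X →
      fderiv ℝ (fun Z => ⟪Y Z, unitGradient F Z⟫) X (w X) =
        ⟪Y X, ν X⟫ * ⟪fderiv ℝ w X (ν X), ν X⟫) :
    ∀ X ∈ sweptSurface S, ⟪Y X, ν X⟫ = 0 := by
  intro X hX
  have hne : (sweptSurface S).Nonempty := ⟨X, hX⟩
  -- The rate `l` dominates the zero-order coefficient divided by the density.
  have hcont : ContinuousOn (fun Z => ‖fderiv ℝ w Z‖ / w Z 0) (sweptSurface S) := by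
    intro Z hZ
    refine ContinuousAt.continuousWithinAt (ContinuousAt.div ?_ ?_ (hpos Z hZ).ne')
    · exact ((hw Z hZ).continuousAt_fderiv (by norm_num)).norm
    · exact (continuous_time.tendsto (w Z)).comp (hw Z hZ).continuousAt
  obtain ⟨q, -, hq⟩ := hS.isCompact_surface.exists_isMaxOn hne hcont
  set l := ‖fderiv ℝ w q‖ / w q 0 + 1 with hl
  have hlt : ∀ Z ∈ sweptSurface S, ‖fderiv ℝ w Z‖ < l * w Z 0 := by
    intro Z hZ
    have h : ‖fderiv ℝ w Z‖ / w Z 0 ≤ ‖fderiv ℝ w q‖ / w q 0 := hq hZ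
    rw [← div_lt_iff₀ (hpos Z hZ)]
    linarith
  have hycont : ContinuousOn (fun Z => ⟪Y Z, ν Z⟫) (sweptSurface S) := by
    intro Z hZ
    obtain ⟨F, hF⟩ := hS.exists_defining Z hZ
    have hev := hF.eventually_normal_eq hS hν
    have h : ContinuousWithinAt (fun V => ⟪Y V, unitGradient F V⟫) (sweptSurface S) Z :=
      ((hY Z hZ).inner ℝ hF.differentiableAt_unitGradient).continuousAt.continuousWithinAt
    refine h.congr_of_eventuallyEq ?_ (by rw [hev.self_of_nhds hZ])
    filter_upwards [mem_nhdsWithin_of_mem_nhds hev, self_mem_nhdsWithin] with V h1 h2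
    rw [h1 h2]
  have hfcont : ContinuousOn (fun Z => (Real.exp (-l * Z 0) * ⟪Y Z, ν Z⟫) ^ 2)
      (sweptSurface S) := by
    have h : Continuous (fun Z : SpaceTime n => Real.exp (-l * Z 0)) :=
      Real.continuous_exp.comp (continuous_const.mul continuous_time)
    exact (h.continuousOn.mul hycont).pow 2
  obtain ⟨p, hp, hmax⟩ := hS.isCompact_surface.exists_isMaxOn hne hfcont
  suffices hyp : ⟪Y p, ν p⟫ = 0 by
    have h : (Real.exp (-l * X 0) * ⟪Y X, ν X⟫) ^ 2 ≤ (Real.exp (-l * p 0) * ⟪Y p, ν p⟫) ^ 2 :=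
      hmax hX
    rw [hyp, mul_zero, zero_pow two_ne_zero] at h
    have h2 := pow_eq_zero_iff (two_ne_zero) |>.1 (le_antisymm h (sq_nonneg _))
    exact (mul_eq_zero.1 h2).resolve_left (Real.exp_ne_zero _)
  by_contra hyp
  have hp0 : 0 < p 0 := lt_of_le_of_ne hp.1 fun h => hyp (hends p hp (Or.inl h.symm))
  have hp1 : p 0 < 1 := lt_of_le_of_ne hp.2.1 fun h => hyp (hends p hp (Or.inr h))
  obtain ⟨F, hF⟩ := hS.exists_defining p hp
  have hev := hF.eventually_normal_eq hS hν
  have hνp : ν p = unitGradient F p := hev.self_of_nhds hp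
  have hyd : HasFDerivAt (fun Z => ⟪Y Z, unitGradient F Z⟫)
      (fderiv ℝ (fun Z => ⟪Y Z, unitGradient F Z⟫) p) p :=
    ((hY p hp).inner ℝ hF.differentiableAt_unitGradient).hasFDerivAt
  have hexp : HasFDerivAt (fun Z : SpaceTime n => Real.exp (-l * Z 0))
      (Real.exp (-l * p 0) • (-l) • (EuclideanSpace.proj (𝕜 := ℝ) (0 : Fin (n + 1)) :
        SpaceTime n →L[ℝ] ℝ)) p :=
    ((EuclideanSpace.proj (𝕜 := ℝ) (0 : Fin (n + 1)) :
      SpaceTime n →L[ℝ] ℝ).hasFDerivAt.const_mul (-l)).exp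
  have hg := (hexp.mul hyd).pow 2
  have h0 := hF.fderiv_eq_zero_of_isMaxOn hp0 hp1 hmax hg.differentiableAt
    (hev.mono fun Z hZ hZS => by simp only [Pi.mul_apply, hZ hZS]) (a := w p)
    (by rw [← hνp, real_inner_comm]; exact hwν p hp)
  rw [hg.fderiv] at h0
  have h1 := htrans p hp F hF
  simp only [Pi.mul_apply, smul_apply, add_apply, smul_eq_mul, h1, ← hνp,
    PiLp.proj_apply] at h0
  have hE := Real.exp_pos (-l * p 0)
  have h2 : (2 * Real.exp (-l * p 0) ^ 2 * ⟪Y p, ν p⟫ ^ 2) *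
      (⟪fderiv ℝ w p (ν p), ν p⟫ - l * w p 0) = 0 := by
    rw [← h0]; simp; ring
  have h3 : ⟪fderiv ℝ w p (ν p), ν p⟫ ≤ ‖fderiv ℝ w p‖ := by
    have hn : ‖ν p‖ = 1 := hνp ▸ hF.norm_unitGradient
    calc _ ≤ ‖fderiv ℝ w p (ν p)‖ * ‖ν p‖ := real_inner_le_norm _ _
      _ ≤ ‖fderiv ℝ w p‖ := by simpa [hn] using (fderiv ℝ w p).le_opNorm (ν p)
  rcases mul_eq_zero.1 h2 with h4 | h4
  · have : 0 < ⟪Y p, ν p⟫ ^ 2 := by positivity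
    have : 0 < 2 * Real.exp (-l * p 0) ^ 2 * ⟪Y p, ν p⟫ ^ 2 := by positivity
    linarith
  · linarith [hlt p hp]

/-! ### The perturbed zero-flux condition -/

theorem mainTheorem1 (n : ℕ) (S : ℝ → Set (EuclideanSpace ℝ (Fin n))) (hS : IsRegularSweep S)
    (ν : SpaceTime n → SpaceTime n)
    (hν : ∀ X ∈ sweptSurface S, IsOutwardUnitNormal S X (ν X))
    (W : ℝ → SpaceTime n → SpaceTime n)
    (hW : ∀ X ∈ spacetimeSupport S,
      ContDiffAt ℝ 1 (fun q : ℝ × SpaceTime n => W q.1 q.2) (0, X))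
    (hdiv : ∀ X ∈ spacetimeSupport S, divergence (W 0) X = 0)
    (hflux : ∀ X ∈ sweptSurface S, ⟪W 0 X, ν X⟫ = 0)
    (Φ N : ℝ → SpaceTime n → SpaceTime n) (hΦ : IsSurfacePerturbation S ν Φ N)
    (hlin : ∀ X ∈ sweptSurface S,
      HasDerivAt (fun ε : ℝ => ⟪W ε (Φ ε X), N ε X⟫) 0 0) :
    (∀ p ∈ sweptSurface S, 0 < p 0 → p 0 < 1 →
      (∃ (x : (Fin n → ℝ) → SpaceTime n) (s₀ : Fin n → ℝ),
        IsPrincipalCoordinates S ν x s₀ p) ∧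
      ∀ (x : (Fin n → ℝ) → SpaceTime n) (s₀ : Fin n → ℝ),
        IsPrincipalCoordinates S ν x s₀ p →
        (∀ i : Fin n, LineDifferentiableAt ℝ
          (fun s => ⟪W 0 (x s), unitTangent x i s⟫ * ⟪firstVariation Φ (x s), ν (x s)⟫)
          s₀ (coordDir i)) ∧
        ⟪firstVariation W p, ν p⟫ =
          ∑ i : Fin n, lineDeriv ℝ
            (fun s => ⟪W 0 (x s), unitTangent x i s⟫ * ⟪firstVariation Φ (x s), ν (x s)⟫)
            s₀ (coordDir i)) ∧
    ((∀ X ∈ sweptSurface S, 0 < W 0 X 0) →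
      (∀ X ∈ sweptSurface S, X 0 = 0 ∨ X 0 = 1 → ⟪firstVariation Φ X, ν X⟫ = 0) →
      (∀ X ∈ sweptSurface S, ⟪firstVariation W X, ν X⟫ = 0) →
      ∀ X ∈ sweptSurface S, ⟪firstVariation Φ X, ν X⟫ = 0) ∧
    ((∀ X ∈ sweptSurface S, ⟪firstVariation Φ X, ν X⟫ = 0) →
      ∀ X ∈ sweptSurface S, ⟪firstVariation W X, ν X⟫ = 0) := by
  have hsub := hS.surface_subset_support
  have hW0 : ∀ X ∈ sweptSurface S, ContDiffAt ℝ 1 (W 0) X := fun X hX =>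
    (hW X (hsub hX)).comp (f := fun Z : SpaceTime n => ((0 : ℝ), Z)) X
      (contDiffAt_const.prodMk contDiffAt_id)
  have hY : ∀ X ∈ sweptSurface S, DifferentiableAt ℝ (firstVariation Φ) X := fun X hX =>
    (hasFDerivAt_firstVariation (hΦ.contDiffAt X hX)).differentiableAt
  have htrans : ∀ X ∈ sweptSurface S, ∀ F : SpaceTime n → ℝ, IsDefiningFunctionAt S F X →
      ⟪firstVariation W X, ν X⟫ =
        fderiv ℝ (fun Z => ⟪firstVariation Φ Z, unitGradient F Z⟫) X (W 0 X) -
          ⟪firstVariation Φ X, ν X⟫ * ⟪fderiv ℝ (W 0) X (ν X), ν X⟫ := fun X hX F hF =>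
    hΦ.inner_firstVariation_eq_transport hS hν hF hX (hW X (hsub hX)) hflux (hlin X hX)
  refine ⟨fun p hp hp0 hp1 => ?_, fun hpos hends hδW => ?_, fun hδΓ X hX => ?_⟩
  · obtain ⟨F, hF⟩ := hS.exists_defining p hp
    refine ⟨hF.exists_principalCoordinates hS hν hp0 hp1, fun x s₀ hx => ?_⟩
    rw [htrans p hp F hF]
    exact hx.transport_eq_sum_lineDeriv hS hν hF ((hW0 p hp).differentiableAt (by norm_num))
      (hY p hp) (hdiv p (hsub hp)) (hflux p hp)
  · refine hS.eq_zero_of_transport hν hW0 hY hflux hpos hends fun X hX F hF => ?_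
    have h := htrans X hX F hF
    rw [hδW X hX] at h
    linarith
  · obtain ⟨F, hF⟩ := hS.exists_defining X hX
    have hev := hF.eventually_normal_eq hS hν
    rw [htrans X hX F hF, hδΓ X hX, zero_mul, sub_zero]
    refine hF.fderiv_eq_zero_of_tangent hX ((hY X hX).inner ℝ hF.differentiableAt_unitGradient)
      (hev.mono fun Z hZ hZS => by rw [← hZ hZS]; exact hδΓ Z hZS) ?_
    rw [← hev.self_of_nhds hX, real_inner_comm]
    exact hflux X hX
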